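/- Conventions. A simplicial set $X$ is *reduced* if it has exactly one vertex, and is an *$N$-simplicial set* if, for all $n\ge 1$, an $n$-simplex is determined by the list $(x_1,\dots,x_n)$ of its consecutive edges; it is then written $[x_1|\cdots|x_n]$, and its edge from the first to the last vertex is its *product* $x_1\cdots x_n$. A *partial group* is a reduced $N$-simplicial set $X$ that has an *inversion*: a simplicial map $\nu\colon X\to X^{\mathrm{op}}$ with $\nu^2=\mathrm{id}$ such that for every simplex $x$ of dimension $n\ge1$ the word $[\nu(x)|x]$ is a $2n$-simplex of $X$ with product the unit $1_X$ (the degenerate edge). The category of partial groups is the full subcategory of simplicial sets on these objects. A simplicial map $\tau\colon X\to B$ is a *fibre bundle with fibre $F$* if it is surjective in each dimension and, for each simplex $b\colon\Delta[n]\to B$, the pull-back of $\tau$ along $b$ is isomorphic over $\Delta[n]$ to the projection $F\times\Delta[n]\to\Delta[n]$. The *normalizer* $N(F)$ of a partial group $F$ is the set of $\eta\in F_1$ such that (i) $[\eta|x|\eta^{-1}]$ is a simplex for all $x\in F_1$ and $x\mapsto {}^{\eta}x=\eta x\eta^{-1}$ extends to an automorphism of $F$, and (ii) for each simplex $[x_1|\cdots|x_n]$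 of $F$ the words $[{}^{\eta}x_1|\cdots|{}^{\eta}x_i|\eta|x_{i+1}|\cdots|x_n]$, $0\le i\le n$, are simplices of $F$ and have the same product. Theorem. The category of partial groups is closed under extensions (fibre bundles): let $\tau\colon X\to B$ be a fibre bundle of simplicial sets with fibre $F$, where $B$ and $F$ are partial groups. Then $X$ is a partial group. Moreover, $X$ has the following explicit model. There are automorphisms $\Psi_g\in\mathrm{Aut}(F)$ for $g\in B_1$ and elements $\eta(g,h)\in N(F)$ for $[g|h]\in B_2$, with $\Psi_1=\mathrm{id}$, $\eta(1,g)=1=\eta(g,1)$, with $$\Psi_g(\Psi_h(x))\cdot\eta(g,h)=\eta(g,h)\cdot\Psi_{gh}(x)\quad\text{for } [g|h]\in B_2,\ x\in F_1,$$ $$\Psi_g(\eta(h,k))\cdot\eta(g,hk)=\eta(g,h)\cdot\eta(gh,k)\quad\text{for } [g|h|k]\in B_3,$$ and a bijection from the set of pairs $(x,g)\in F_1\times B_1$ to $X_1$, under which $\tau(x,g)=g$, the unit of $X$ is $(1,1)$, a word $[(x_1,g_1)|\cdots|(x_n,g_n)]$ is a simplex of $X$ if and only if $[g_1|\cdots|g_n]\in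 B_n$ and $$[x_1|\Psi_{g_1}(x_2)\,\eta(g_1,g_2)|\cdots|\Psi_{g_1\cdots g_{n-1}}(x_n)\,\eta(g_1\cdots g_{n-1},g_n)]\in F_n,$$ and the product of a simplex $[(x_1,g_1)|(x_2,g_2)]$ of $X$ is given by $$(x_1,g_1)(x_2,g_2)=\bigl(x_1\cdot\Psi_{g_1}(x_2)\cdot\eta(g_1,g_2),\ g_1g_2\bigr).$$ -/

import Mathlib

open CategoryTheory MonoidalCategory Opposite Simplicial

universe u

namespace PartialGroups

/-- The enumerating operator: the list of the consecutive edges `0 → 1 → ⋯ → n` of an `n`-simplex. -/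
def enum (X : SSet.{u}) {n : ℕ} (x : X _⦋n⦌) : Fin n → X _⦋1⦌ :=
  fun i => X.map (SimplexCategory.mkOfSucc i).op x

/-- The product operator: the edge `0 → n` of an `n`-simplex. -/
def total (X : SSet.{u}) {n : ℕ} (x : X _⦋n⦌) : X _⦋1⦌ :=
  X.map (SimplexCategory.diag n).op x

/-- `X` has exactly one vertex. -/
def IsReduced (X : SSet.{u}) : Prop := ∃! _v : X _⦋0⦌, True

/-- `X` is an `N`-simplicial set: a simplex of dimension `n ≥ 1` is determined by its
consecutive edges. -/
def IsN (X : SSet.{u}) : Prop :=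
  ∀ n : ℕ, 1 ≤ n → Function.Injective (enum X : X _⦋n⦌ → Fin n → X _⦋1⦌)

/-- The word `w = (x₁, …, xₙ)` is (the list of edges of) a simplex `[x₁|⋯|xₙ]` of `X`, and the
product `x₁ ⋯ xₙ` of this simplex is `z`. -/
def IsProd (X : SSet.{u}) {n : ℕ} (w : Fin n → X _⦋1⦌) (z : X _⦋1⦌) : Prop :=
  ∃ x : X _⦋n⦌, enum X x = w ∧ total X x = z

/-- `e` is the degenerate edge at some vertex; in a reduced simplicial set, `e` is the unit. -/
def IsOne (X : SSet.{u}) (e : X _⦋1⦌) : Prop := ∃ v : X _⦋0⦌, e = X.σ 0 v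

/-- An inversion: an anti-involution `ν : X ⟶ X.op` such that, for each simplex `x` of dimension
`n ≥ 1`, the concatenated word `[ν x|x]` is a `2n`-simplex of `X` whose product is the unit. -/
structure Inversion (X : SSet.{u}) where
  /-- the anti-involution -/
  ν : X ⟶ X.op
  involutive : ν ≫ SSet.opFunctor.map ν = SSet.opFunctorCompOpFunctorIso.inv.app X
  left_inv : ∀ n : ℕ, 1 ≤ n → ∀ x : X _⦋n⦌, ∃ e : X _⦋1⦌, IsOne X e ∧
    IsProd X (Fin.append (enum X (SSet.opObjEquiv (ν.app (op ⦋n⦌) x))) (enum X x)) e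

/-- A partial group: a reduced `N`-simplicial set that has an inversion. Partial groups form the
full subcategory of the category of simplicial sets on these objects. -/
def IsPartialGroup : ObjectProperty SSet.{u} :=
  fun X => IsReduced X ∧ IsN X ∧ Nonempty (Inversion X)

/-- `τ : X ⟶ B` is a fibre bundle with fibre `F`: it is onto and, for each simplex
`b : Δ[n] ⟶ B`, the pull-back of `τ` along `b` is isomorphic over `Δ[n]` to the projection
`F × Δ[n] ⟶ Δ[n]`. -/
def IsFibreBundle (F : SSet.{u}) {X B : SSet.{u}} (τ : X ⟶ B) : Prop :=
  (∀ n : ℕ, Function.Surjective (τ.app (op ⦋n⦌))) ∧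
  ∀ (n : ℕ) (b : B _⦋n⦌), ∃ α : F ⊗ Δ[n] ⟶ X,
    IsPullback α (SemiCartesianMonoidalCategory.snd F Δ[n]) τ (SSet.yonedaEquiv.symm b)

/-- The edge `i → j` of a simplex. -/
def edge (X : SSet.{u}) {n : ℕ} (x : X _⦋n⦌) (i j : Fin (n + 1)) (h : i ≤ j) : X _⦋1⦌ :=
  X.map (SimplexCategory.mkOfLe i j h).op x

/-- The two-dimensional face `i → j → k` of a simplex. -/
def face (X : SSet.{u}) {n : ℕ} (x : X _⦋n⦌) (i j k : Fin (n + 1)) (h : i ≤ j) (h' : j ≤ k) :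
    X _⦋2⦌ :=
  X.map (SimplexCategory.mkOfLeComp i j k h h').op x

/-- The action of an automorphism of `X` on the edges of `X`. -/
def act {X : SSet.{u}} (c : X ≅ X) (x : X _⦋1⦌) : X _⦋1⦌ := c.hom.app (op ⦋1⦌) x

/-- `y` is an inverse of the edge `x`: the word `[y|x]` is a simplex, with product the unit. -/
def IsInverse (X : SSet.{u}) (x y : X _⦋1⦌) : Prop :=
  ∃ e : X _⦋1⦌, IsOne X e ∧ IsProd X ![y, x] e

/-- `η` lies in the normalizer `N(X)`: left conjugation `x ↦ η x η⁻¹` is defined on all edges and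
is the restriction of an automorphism `c` of `X`, and for each simplex `[x₁|⋯|xₙ]` the words
`[c x₁|⋯|c xᵢ|η|xᵢ₊₁|⋯|xₙ]`, `0 ≤ i ≤ n`, are simplices which all have the same product. -/
def IsNormalizing (X : SSet.{u}) (η : X _⦋1⦌) : Prop :=
  ∃ c : X ≅ X,
    (∃ η' : X _⦋1⦌, IsInverse X η η' ∧ ∀ x : X _⦋1⦌, IsProd X ![η, x, η'] (act c x)) ∧
    ∀ (n : ℕ) (x : X _⦋n⦌), ∃ z : X _⦋1⦌, ∀ i : Fin (n + 1),
      IsProd X (i.insertNth (α := fun _ => X _⦋1⦌) η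
        (fun j => if j.castSucc < i then act c (enum X x j) else enum X x j)) z

/-- A (normalized) twisting pair: automorphisms `Ψ g` of `F` for the edges `g` of `B`, and elements
`η(g, h)` of the normalizer of `F` for the 2-simplices `[g|h]` of `B`, subject to
`Ψ 1 = id`, `η(1, g) = 1 = η(g, 1)`, the relation `Ψ_g (Ψ_h x) · η(g, h) = η(g, h) · Ψ_{gh} x`
and the cocycle formula `Ψ_g (η(h, k)) · η(g, hk) = η(g, h) · η(gh, k)`. -/
structure TwistingPair (F B : SSet.{u}) where
  /-- the automorphisms -/
  Ψ : B _⦋1⦌ → (F ≅ F)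
  /-- the normalizing elements -/
  η : B _⦋2⦌ → F _⦋1⦌
  normalizing : ∀ b : B _⦋2⦌, IsNormalizing F (η b)
  Ψ_one : ∀ g : B _⦋1⦌, IsOne B g → Ψ g = Iso.refl F
  η_one_left : ∀ g : B _⦋1⦌, IsOne F (η (B.σ 0 g))
  η_one_right : ∀ g : B _⦋1⦌, IsOne F (η (B.σ 1 g))
  homotopy : ∀ (b : B _⦋2⦌) (x : F _⦋1⦌), ∃ z : F _⦋1⦌,
    IsProd F ![act (Ψ (enum B b 0)) (act (Ψ (enum B b 1)) x), η b] z ∧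
    IsProd F ![η b, act (Ψ (total B b)) x] z
  cocycle : ∀ b : B _⦋3⦌, ∃ z : F _⦋1⦌,
    IsProd F ![act (Ψ (enum B b 0)) (η (face B b 1 2 3 (by decide) (by decide))),
      η (face B b 0 1 3 (by decide) (by decide))] z ∧
    IsProd F ![η (face B b 0 1 2 (by decide) (by decide)),
      η (face B b 0 2 3 (by decide) (by decide))] z

/-- The word `((x₁, g₁), …, (xₙ, gₙ))` is a simplex of the explicit extension determined by the
twisting pair `P`: `[g₁|⋯|gₙ]` is a simplex of `B` and
`[x₁|Ψ_{g₁}(x₂)·η(g₁, g₂)|⋯|Ψ_{g₁⋯gₙ₋₁}(xₙ)·η(g₁⋯gₙ₋₁, gₙ)]` is a simplex of `F`. -/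
def TwistingPair.IsWord {F B : SSet.{u}} (P : TwistingPair F B) {n : ℕ}
    (w : Fin n → F _⦋1⦌ × B _⦋1⦌) : Prop :=
  ∃ (b : B _⦋n⦌) (y : F _⦋n⦌), enum B b = (fun k => (w k).2) ∧
    ∀ k : Fin n, IsProd F
      ![act (P.Ψ (edge B b 0 k.castSucc (Fin.zero_le _))) (w k).1,
        P.η (face B b 0 k.castSucc k.succ (Fin.zero_le _) k.castSucc_le_succ)] (enum F y k)

/-- `(z, h)` is the product of `(x₁, g₁)` and `(x₂, g₂)` in the explicit extension determined by
`P`: `[g₁|g₂]` is a simplex of `B` and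
`(z, h) = (x₁ · Ψ_{g₁}(x₂) · η(g₁, g₂), g₁ · g₂)`. -/
def TwistingPair.IsMul {F B : SSet.{u}} (P : TwistingPair F B)
    (p q r : F _⦋1⦌ × B _⦋1⦌) : Prop :=
  ∃ b : B _⦋2⦌, enum B b = ![p.2, q.2] ∧ total B b = r.2 ∧
    IsProd F ![p.1, act (P.Ψ p.2) q.1, P.η b] r.1

/-- The bijection `e` from pairs `(x, g)` to the edges of `X` identifies the bundle `τ : X ⟶ B`
with the explicit extension determined by `P`: it is compatible with the projections to `B` and
with units, a word is a simplex of `X` iff it is one of the explicit extension, and the products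
agree. Since a simplex of a reduced `N`-simplicial set is determined by its edges, this describes
all simplices, faces and degeneracies of `X`. -/
structure IsExplicitModel {F X B : SSet.{u}} (τ : X ⟶ B) (P : TwistingPair F B)
    (e : F _⦋1⦌ × B _⦋1⦌ ≃ X _⦋1⦌) : Prop where
  proj : ∀ p, τ.app (op ⦋1⦌) (e p) = p.2
  one : ∀ p, IsOne X (e p) ↔ IsOne F p.1 ∧ IsOne B p.2
  word : ∀ (n : ℕ) (w : Fin n → F _⦋1⦌ × B _⦋1⦌),
    (∃ x : X _⦋n⦌, enum X x = fun k => e (w k)) ↔ P.IsWord w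
  mul : ∀ p q r, IsProd X ![e p, e q] (e r) ↔ P.IsMul p q r

end PartialGroups

/-! Over each simplex b of B the bundle is a product, so a simplex of X over b acquires a coordinate
in F once a trivialization over b is chosen. Two choices differ by a gauge, a family of bijections F
× Δ[n] → F over Δ[n]. The whole proof consists in choosing trivializations well. The tool is
`IsTrivialization.exists_glue`: a trivialization can be altered from the vertex k on, so as to have
prescribed values over one edge p → k, without changing it over the earlier vertices. Going through
the vertices in order, one can prescribe it along a tree of edges.

Closure under extensions. Reducedness and the N-property are read off in coordinates. An inversion
is a structure, which does not visibly lift; it is replaced by the property `HasInverses`, which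
asks for extensions of simplices in which certain edges are units, and for uniqueness of left
inverses. In a trivialization that is constant along the edges in question, an edge of X is a unit
exactly when its coordinate is, so the property passes from F and B to X.

Explicit model. Trivialize the bundle over every edge g, starting from one fixed trivialization at
the vertex; comparison at the far end gives Ψ_g. Over an n-simplex take a "fan", a trivialization
that agrees with these along all edges 0 → k. Over an edge j → k the fan differs from the chosen
trivialization by a gauge over Δ[1], and η is the value of this gauge at the unit. A gauge over Δ[1]
is a homotopy between automorphisms of F: the prism decomposition shows that η normalizes F and that
the gauge sends x to Ψ(x)·η. Hence the fan coordinate of a simplex with edges (x_k, g_k) has exactly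
the edges in the word condition, and the cocycle formula is the product of the unit sections read in
the fan of a 3-simplex. -/

namespace PartialGroups

/-! ### Edges, units and products -/

section Edges

variable {X Y : SSet.{u}}

theorem map_map (X : SSet.{u}) {k m n : ℕ} (u : ⦋k⦌ ⟶ ⦋m⦌) (v : ⦋m⦌ ⟶ ⦋n⦌) (x : X _⦋n⦌) :
    X.map u.op (X.map v.op x) = X.map (u ≫ v).op x := by
  simp

theorem app_map (f : X ⟶ Y) {m n : ℕ} (u : ⦋m⦌ ⟶ ⦋n⦌) (x : X _⦋n⦌) :
    f.app (op ⦋m⦌) (X.map u.op x) = Y.map u.op (f.app (op ⦋n⦌) x) :=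
  NatTrans.naturality_apply f u.op x

theorem mkOfLe_comp {m n : ℕ} (u : ⦋m⦌ ⟶ ⦋n⦌) (i j : Fin (m + 1)) (h : i ≤ j) :
    SimplexCategory.mkOfLe i j h ≫ u =
      SimplexCategory.mkOfLe (u.toOrderHom i) (u.toOrderHom j) (u.toOrderHom.monotone h) :=
  SimplexCategory.Hom.ext_one_left _ _

theorem edge_map {m n : ℕ} (u : ⦋m⦌ ⟶ ⦋n⦌) (x : X _⦋n⦌) (i j : Fin (m + 1)) (h : i ≤ j) :
    edge X (X.map u.op x) i j h =
      edge X x (u.toOrderHom i) (u.toOrderHom j) (u.toOrderHom.monotone h) := by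
  unfold edge
  rw [map_map, mkOfLe_comp]

theorem app_edge (f : X ⟶ Y) {n : ℕ} (x : X _⦋n⦌) (i j : Fin (n + 1)) (h : i ≤ j) :
    f.app (op ⦋1⦌) (edge X x i j h) = edge Y (f.app (op ⦋n⦌) x) i j h :=
  app_map f _ x

theorem mkOfSucc_eq {n : ℕ} (i : Fin n) :
    SimplexCategory.mkOfSucc i = SimplexCategory.mkOfLe i.castSucc i.succ i.castSucc_le_succ :=
  SimplexCategory.Hom.ext_one_left _ _

theorem enum_eq {n : ℕ} (x : X _⦋n⦌) (i : Fin n) :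
    enum X x i = edge X x i.castSucc i.succ i.castSucc_le_succ := by
  unfold enum edge
  rw [mkOfSucc_eq]

theorem app_enum (f : X ⟶ Y) {n : ℕ} (x : X _⦋n⦌) (i : Fin n) :
    f.app (op ⦋1⦌) (enum X x i) = enum Y (f.app (op ⦋n⦌) x) i :=
  app_map f _ x

theorem total_eq {n : ℕ} (x : X _⦋n⦌) :
    total X x = edge X x 0 (Fin.last n) (Fin.zero_le _) := rfl

theorem edge_self_one (x : X _⦋1⦌) : edge X x 0 1 (by decide) = x := by
  have : SimplexCategory.mkOfLe (n := 1) 0 1 (by decide) = 𝟙 _ :=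
    SimplexCategory.Hom.ext_one_left _ _
  simp [edge, this]

theorem isOne_iff {e : X _⦋1⦌} :
    IsOne X e ↔ ∃ v : X _⦋0⦌, e = X.map (SimplexCategory.const ⦋1⦌ ⦋0⦌ 0).op v := by
  have : SimplexCategory.σ (0 : Fin 1) = SimplexCategory.const ⦋1⦌ ⦋0⦌ 0 :=
    Subsingleton.elim _ _
  unfold IsOne SimplicialObject.σ
  rw [this]

theorem isOne_map_const {n : ℕ} (x : X _⦋n⦌) (i : Fin (n + 1)) :
    IsOne X (X.map (SimplexCategory.const ⦋1⦌ ⦋n⦌ i).op x) :=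
  isOne_iff.2 ⟨X.map (SimplexCategory.const ⦋0⦌ ⦋n⦌ i).op x, by rw [map_map]; rfl⟩

theorem isOne_edge_self {n : ℕ} (x : X _⦋n⦌) (i : Fin (n + 1)) (h : i ≤ i) :
    IsOne X (edge X x i i h) := by
  unfold edge
  rw [SimplexCategory.mkOfLe_refl]
  exact isOne_map_const x i

theorem IsOne.app {e : X _⦋1⦌} (he : IsOne X e) (f : X ⟶ Y) : IsOne Y (f.app (op ⦋1⦌) e) := by
  obtain ⟨v, rfl⟩ := isOne_iff.1 he
  rw [app_map]
  exact isOne_map_const _ _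

theorem IsReduced.vertex_eq (hX : IsReduced X) (v w : X _⦋0⦌) : v = w :=
  hX.unique trivial trivial

theorem IsReduced.one_eq (hX : IsReduced X) {e e' : X _⦋1⦌} (he : IsOne X e) (he' : IsOne X e') :
    e = e' := by
  obtain ⟨v, rfl⟩ := he
  obtain ⟨w, rfl⟩ := he'
  rw [hX.vertex_eq v w]

theorem IsReduced.exists_one (hX : IsReduced X) : ∃ e : X _⦋1⦌, IsOne X e := by
  obtain ⟨v, -⟩ := hX
  exact ⟨_, v, rfl⟩

theorem IsN.ext (hX : IsN X) {n : ℕ} (hn : 1 ≤ n) {x y : X _⦋n⦌}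
    (h : ∀ i : Fin n, edge X x i.castSucc i.succ i.castSucc_le_succ =
      edge X y i.castSucc i.succ i.castSucc_le_succ) : x = y :=
  hX n hn (funext fun i => by rw [enum_eq, enum_eq, h])

theorem edge_face {n : ℕ} (x : X _⦋n⦌) (i j k : Fin (n + 1)) (h : i ≤ j) (h' : j ≤ k)
    (p q : Fin 3) (hpq : p ≤ q) :
    edge X (face X x i j k h h') p q hpq =
      edge X x ((SimplexCategory.mkOfLeComp i j k h h').toOrderHom p)
        ((SimplexCategory.mkOfLeComp i j k h h').toOrderHom q)
        ((SimplexCategory.mkOfLeComp i j k h h').toOrderHom.monotone hpq) :=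
  edge_map _ _ _ _ _

theorem edge_face_zero_one {n : ℕ} (x : X _⦋n⦌) (i j k : Fin (n + 1)) (h : i ≤ j) (h' : j ≤ k) :
    edge X (face X x i j k h h') 0 1 (by decide) = edge X x i j h :=
  edge_map _ _ _ _ _

theorem edge_face_one_two {n : ℕ} (x : X _⦋n⦌) (i j k : Fin (n + 1)) (h : i ≤ j) (h' : j ≤ k) :
    edge X (face X x i j k h h') 1 2 (by decide) = edge X x j k h' :=
  edge_map _ _ _ _ _

theorem edge_face_zero_two {n : ℕ} (x : X _⦋n⦌) (i j k : Fin (n + 1)) (h : i ≤ j) (h' : j ≤ k) :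
    edge X (face X x i j k h h') 0 2 (by decide) = edge X x i k (h.trans h') :=
  edge_map _ _ _ _ _

theorem IsN.ext_two (hX : IsN X) {x y : X _⦋2⦌}
    (h : edge X x 0 1 (by decide) = edge X y 0 1 (by decide))
    (h' : edge X x 1 2 (by decide) = edge X y 1 2 (by decide)) : x = y := by
  refine hX.ext (by norm_num) fun i => ?_
  fin_cases i
  · exact h
  · exact h'

/-- The triangle i → j → k has the same consecutive edges as a degenerate triangle on j → k, so the
two coincide by the N-property. -/
theorem edge_eq_of_isOne_left (hX : IsReduced X) (hN : IsN X) {n : ℕ} (x : X _⦋n⦌)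
    {i j k : Fin (n + 1)} (h : i ≤ j) (h' : j ≤ k) (hx : IsOne X (edge X x i j h)) :
    edge X x i k (h.trans h') = edge X x j k h' := by
  have key : face X x i j k h h' = face X (edge X x j k h') 0 0 1 (by decide) (by decide) := by
    refine hN.ext_two ?_ ?_
    · rw [edge_face_zero_one, edge_face_zero_one]
      exact hX.one_eq hx (isOne_edge_self _ _ _)
    · rw [edge_face_one_two, edge_face_one_two, edge_self_one]
  rw [← edge_face_zero_two x i j k h h', key, edge_face_zero_two, edge_self_one]

theorem edge_eq_of_isOne_right (hX : IsReduced X) (hN : IsN X) {n : ℕ} (x : X _⦋n⦌)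
    {i j k : Fin (n + 1)} (h : i ≤ j) (h' : j ≤ k) (hx : IsOne X (edge X x j k h')) :
    edge X x i k (h.trans h') = edge X x i j h := by
  have key : face X x i j k h h' = face X (edge X x i j h) 0 1 1 (by decide) (by decide) := by
    refine hN.ext_two ?_ ?_
    · rw [edge_face_zero_one, edge_face_zero_one, edge_self_one]
    · rw [edge_face_one_two, edge_face_one_two]
      exact hX.one_eq hx (isOne_edge_self _ _ _)
  rw [← edge_face_zero_two x i j k h h', key, edge_face_zero_two, edge_self_one]

theorem isProd_two_iff {a b z : X _⦋1⦌} :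
    IsProd X ![a, b] z ↔ ∃ c : X _⦋2⦌, edge X c 0 1 (by decide) = a ∧
      edge X c 1 2 (by decide) = b ∧ edge X c 0 2 (by decide) = z := by
  refine exists_congr fun c => ?_
  rw [← and_assoc]
  refine and_congr ⟨fun h => ?_, fun h => ?_⟩ Iff.rfl
  · exact ⟨(enum_eq c 0).symm.trans (congrFun h 0), (enum_eq c 1).symm.trans (congrFun h 1)⟩
  · funext i
    fin_cases i
    · exact (enum_eq c 0).trans h.1
    · exact (enum_eq c 1).trans h.2

theorem isProd_three_iff {a b c z : X _⦋1⦌} :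
    IsProd X ![a, b, c] z ↔ ∃ d : X _⦋3⦌, edge X d 0 1 (by decide) = a ∧
      edge X d 1 2 (by decide) = b ∧ edge X d 2 3 (by decide) = c ∧
      edge X d 0 3 (by decide) = z := by
  refine exists_congr fun d => ?_
  rw [← and_assoc (c := edge X d 0 3 _ = z), ← and_assoc (c := edge X d 0 3 _ = z), and_assoc]
  constructor
  · rintro ⟨h, h'⟩
    exact ⟨(enum_eq d 0).symm.trans (congrFun h 0), ⟨(enum_eq d 1).symm.trans (congrFun h 1),
      (enum_eq d 2).symm.trans (congrFun h 2)⟩, h'⟩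
  · rintro ⟨h0, ⟨h1, h2⟩, h'⟩
    refine ⟨?_, h'⟩
    funext i
    fin_cases i
    · exact (enum_eq d 0).trans h0
    · exact (enum_eq d 1).trans h1
    · exact (enum_eq d 2).trans h2

theorem IsN.isProd_two_unique (hN : IsN X) {a b z z' : X _⦋1⦌} (h : IsProd X ![a, b] z)
    (h' : IsProd X ![a, b] z') : z = z' := by
  obtain ⟨c, h1, h2⟩ := h
  obtain ⟨c', h1', h2'⟩ := h'
  obtain rfl := hN 2 (by norm_num) (h1.trans h1'.symm)
  exact h2.symm.trans h2'

end Edges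
-- Families and gauges
/-- A simplicial map `F × Δ[n] ⟶ X`, in terms of its values on pairs of simplices. -/
@[ext]
structure Family (F X : SSet.{u}) (n : ℕ) where
  /-- the value on the pair `(f, θ)` -/
  app : ∀ {m : ℕ}, (⦋m⦌ ⟶ ⦋n⦌) → F _⦋m⦌ → X _⦋m⦌
  map_app : ∀ {k m : ℕ} (u : ⦋k⦌ ⟶ ⦋m⦌) (θ : ⦋m⦌ ⟶ ⦋n⦌) (f : F _⦋m⦌),
    X.map u.op (app θ f) = app (u ≫ θ) (F.map u.op f)

namespace Family

variable {F G X B : SSet.{u}} {n : ℕ}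

/-- The family obtained by reindexing along a map of standard simplices. -/
def pull (α : Family F X n) {k : ℕ} (v : ⦋k⦌ ⟶ ⦋n⦌) : Family F X k where
  app θ f := α.app (θ ≫ v) f
  map_app u θ f := by rw [α.map_app, Category.assoc]

/-- The composition of families over the same standard simplex. -/
def comp (α : Family G X n) (H : Family F G n) : Family F X n where
  app θ f := α.app θ (H.app θ f)
  map_app u θ f := by rw [α.map_app, H.map_app]

@[simp]
theorem pull_app (α : Family F X n) {k m : ℕ} (v : ⦋k⦌ ⟶ ⦋n⦌) (θ : ⦋m⦌ ⟶ ⦋k⦌) (f : F _⦋m⦌) :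
    (α.pull v).app θ f = α.app (θ ≫ v) f := rfl

@[simp]
theorem comp_app (α : Family G X n) (H : Family F G n) {m : ℕ} (θ : ⦋m⦌ ⟶ ⦋n⦌) (f : F _⦋m⦌) :
    (α.comp H).app θ f = α.app θ (H.app θ f) := rfl

theorem edge_app (α : Family F X n) {m : ℕ} (θ : ⦋m⦌ ⟶ ⦋n⦌) (f : F _⦋m⦌) (i j : Fin (m + 1))
    (h : i ≤ j) :
    edge X (α.app θ f) i j h = α.app (SimplexCategory.mkOfLe (θ.toOrderHom i) (θ.toOrderHom j)
      (θ.toOrderHom.monotone h)) (edge F f i j h) := by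
  rw [← mkOfLe_comp]
  exact α.map_app _ _ _

theorem isOne_app_const (α : Family F X n) (i : Fin (n + 1)) {e : F _⦋1⦌} (he : IsOne F e) :
    IsOne X (α.app (SimplexCategory.const ⦋1⦌ ⦋n⦌ i) e) := by
  obtain ⟨v, rfl⟩ := isOne_iff.1 he
  exact isOne_iff.2 ⟨_, (α.map_app (SimplexCategory.const ⦋1⦌ ⦋0⦌ 0)
    (SimplexCategory.const ⦋0⦌ ⦋n⦌ i) v).symm⟩

/-- A family of bijections. -/
def IsGauge (H : Family F F n) : Prop :=
  ∀ (m : ℕ) (θ : ⦋m⦌ ⟶ ⦋n⦌), Function.Bijective (H.app θ)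

theorem IsGauge.pull {H : Family F F n} (hH : H.IsGauge) {k : ℕ} (v : ⦋k⦌ ⟶ ⦋n⦌) :
    (H.pull v).IsGauge := fun m θ => hH m (θ ≫ v)

/-- A family of bijections has an inverse. -/
theorem IsGauge.exists_inv {H : Family F F n} (hH : H.IsGauge) : ∃ H' : Family F F n,
    (∀ {m : ℕ} (θ : ⦋m⦌ ⟶ ⦋n⦌) (f : F _⦋m⦌), H'.app θ (H.app θ f) = f) ∧
    ∀ {m : ℕ} (θ : ⦋m⦌ ⟶ ⦋n⦌) (f : F _⦋m⦌), H.app θ (H'.app θ f) = f :=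
  ⟨{ app := fun θ => (Equiv.ofBijective _ (hH _ θ)).symm
     map_app := fun u θ f => by
       apply (hH _ (u ≫ θ)).1
       rw [← H.map_app]
       exact (congrArg _ (Equiv.ofBijective_apply_symm_apply _ (hH _ θ) f)).trans
         (Equiv.ofBijective_apply_symm_apply _ (hH _ (u ≫ θ)) _).symm },
    fun θ f => Equiv.ofBijective_symm_apply_apply _ (hH _ θ) f,
    fun θ f => Equiv.ofBijective_apply_symm_apply _ (hH _ θ) f⟩

/-- The automorphism to which a gauge restricts at a vertex. -/
theorem IsGauge.exists_iso {H : Family F F n} (hH : H.IsGauge) (i : Fin (n + 1)) :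
    ∃ φ : F ≅ F, ∀ {m : ℕ} (f : F _⦋m⦌),
      φ.hom.app (op ⦋m⦌) f = H.app (SimplexCategory.const ⦋m⦌ ⦋n⦌ i) f := by
  obtain ⟨H', h₁, h₂⟩ := hH.exists_inv
  let mkMap (K : Family F F n) : F ⟶ F :=
    { app := fun m => ↾fun f => K.app (SimplexCategory.const ⦋m.unop.len⦌ ⦋n⦌ i) f
      naturality := fun m k u => by
        ext f
        exact (K.map_app (m := m.unop.len) (k := k.unop.len) u.unop
          (SimplexCategory.const ⦋m.unop.len⦌ ⦋n⦌ i) f).symm }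
  refine ⟨⟨mkMap H, mkMap H', ?_, ?_⟩, fun f => rfl⟩
  · ext m f
    exact h₁ (m := m.unop.len) _ f
  · ext m f
    exact h₂ (m := m.unop.len) _ f

end Family

/-! ### Trivializations and gluing -/

/-- The family `α` is an isomorphism from `F × Δ[n]` to the pull-back of `τ` along `b`. -/
structure IsTrivialization {F X B : SSet.{u}} (τ : X ⟶ B) {n : ℕ} (b : B _⦋n⦌)
    (α : Family F X n) : Prop where
  proj : ∀ {m : ℕ} (θ : ⦋m⦌ ⟶ ⦋n⦌) (f : F _⦋m⦌), τ.app (op ⦋m⦌) (α.app θ f) = B.map θ.op b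
  injective : ∀ {m : ℕ} (θ : ⦋m⦌ ⟶ ⦋n⦌), Function.Injective (α.app θ)
  exists_eq : ∀ {m : ℕ} (θ : ⦋m⦌ ⟶ ⦋n⦌) (x : X _⦋m⦌), τ.app (op ⦋m⦌) x = B.map θ.op b →
    ∃ f, α.app θ f = x

section

variable {F X B : SSet.{u}} {τ : X ⟶ B} {n : ℕ} {b : B _⦋n⦌} {α β : Family F X n}

theorem IsFibreBundle.exists_isTrivialization (hτ : IsFibreBundle F τ) (b : B _⦋n⦌) :
    ∃ α : Family F X n, IsTrivialization τ b α := by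
  obtain ⟨a, ha⟩ := hτ.2 n b
  let α : Family F X n :=
    { app := fun {m} θ f => a.app (op ⦋m⦌) (f, SSet.stdSimplex.objEquiv.symm θ)
      map_app := fun u θ f => (app_map a u (f, SSet.stdSimplex.objEquiv.symm θ)).symm }
  have hb : ∀ {m : ℕ} (θ : ⦋m⦌ ⟶ ⦋n⦌), (SSet.yonedaEquiv.symm b).app (op ⦋m⦌)
      (SSet.stdSimplex.objEquiv.symm θ) = B.map θ.op b := fun θ => rfl
  have hp : ∀ m : ℕ, IsPullback (a.app (op ⦋m⦌))
      ((SemiCartesianMonoidalCategory.snd F Δ[n]).app (op ⦋m⦌)) (τ.app (op ⦋m⦌))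
      ((SSet.yonedaEquiv.symm b).app (op ⦋m⦌)) :=
    fun m => ha.map ((evaluation _ _).obj (op ⦋m⦌))
  refine ⟨α, ⟨fun {m} θ f => ?_, fun {m} θ f f' h => ?_, fun {m} θ x hx => ?_⟩⟩
  · exact (congrArg (fun k => k (f, SSet.stdSimplex.objEquiv.symm θ)) (hp m).w).trans (hb θ)
  · have := (Limits.Types.ext_of_isPullback (hp m)
      (x₁ := (f, SSet.stdSimplex.objEquiv.symm θ))
      (y₁ := (f', SSet.stdSimplex.objEquiv.symm θ)) h rfl)
    exact congrArg Prod.fst this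
  · obtain ⟨⟨f, θ'⟩, h₁, h₂⟩ := Limits.Types.exists_of_isPullback (hp m) x
      (SSet.stdSimplex.objEquiv.symm θ) (hx.trans (hb θ).symm)
    obtain rfl : θ' = SSet.stdSimplex.objEquiv.symm θ := h₂
    exact ⟨f, h₁⟩

namespace IsTrivialization

theorem pull (hα : IsTrivialization τ b α) {k : ℕ} (v : ⦋k⦌ ⟶ ⦋n⦌) :
    IsTrivialization τ (B.map v.op b) (α.pull v) where
  proj θ f := by rw [map_map]; exact hα.proj _ f
  injective θ := hα.injective _
  exists_eq θ x hx := hα.exists_eq _ x (by rw [hx, map_map])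

theorem comp (hα : IsTrivialization τ b α) {H : Family F F n} (hH : H.IsGauge) :
    IsTrivialization τ b (α.comp H) where
  proj θ f := hα.proj θ _
  injective θ := (hα.injective θ).comp (hH _ θ).1
  exists_eq θ x hx := by
    obtain ⟨f, rfl⟩ := hα.exists_eq θ x hx
    obtain ⟨f', rfl⟩ := (hH _ θ).2 f
    exact ⟨f', rfl⟩

/-- Two trivializations over the same simplex differ by a gauge. -/
theorem exists_gauge (hα : IsTrivialization τ b α) (hβ : IsTrivialization τ b β) :
    ∃ H : Family F F n, H.IsGauge ∧
      ∀ {m : ℕ} (θ : ⦋m⦌ ⟶ ⦋n⦌) (f : F _⦋m⦌), α.app θ (H.app θ f) = β.app θ f := by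
  choose h hh using fun {m : ℕ} (θ : ⦋m⦌ ⟶ ⦋n⦌) (f : F _⦋m⦌) =>
    hα.exists_eq θ (β.app θ f) (hβ.proj θ f)
  refine ⟨⟨h, fun u θ f => hα.injective (u ≫ θ) ?_⟩, fun m θ => ⟨fun f f' hff => ?_, fun f => ?_⟩,
    hh⟩
  · rw [← α.map_app, hh, hh, β.map_app]
  · apply hβ.injective θ
    rw [← hh, ← hh]
    exact congrArg _ hff
  · obtain ⟨f', hf'⟩ := hβ.exists_eq θ (α.app θ f) (hα.proj θ f)
    exact ⟨f', hα.injective θ ((hh θ f').trans hf')⟩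

end IsTrivialization

/-- The characteristic map of the set of the vertices `≥ k`. -/
def charMap {n : ℕ} (k : Fin (n + 1)) : ⦋n⦌ ⟶ ⦋1⦌ :=
  SimplexCategory.mkHom
    { toFun := fun j => if j < k then 0 else 1
      monotone' := fun i j h => by
        dsimp only
        split_ifs with h₁ h₂ h₂
        · exact le_rfl
        · exact Fin.zero_le _
        · exact absurd (h.trans_lt h₂) h₁
        · exact le_rfl }

theorem charMap_of_lt {k j : Fin (n + 1)} (h : j < k) : (charMap k).toOrderHom j = 0 := if_pos h

theorem charMap_of_le {k j : Fin (n + 1)} (h : k ≤ j) : (charMap k).toOrderHom j = 1 :=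
  if_neg h.not_gt

theorem mkOfLe_comp_charMap {p k : Fin (n + 1)} (h : p < k) :
    SimplexCategory.mkOfLe p k h.le ≫ charMap k = 𝟙 _ :=
  SimplexCategory.Hom.ext_one_left _ _ (charMap_of_lt h) (charMap_of_le le_rfl)

theorem comp_charMap_of_lt {m : ℕ} {k : Fin (n + 1)} (θ : ⦋m⦌ ⟶ ⦋n⦌)
    (h : ∀ i, θ.toOrderHom i < k) : θ ≫ charMap k = SimplexCategory.const ⦋m⦌ ⦋1⦌ 0 := by
  ext i : 3
  exact charMap_of_lt (h i)

/-- A trivialization can be changed at the vertices `≥ k` so as to take on given values on an edge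
from an earlier vertex to `k`. -/
theorem IsTrivialization.exists_glue (hα : IsTrivialization τ b α) {p k : Fin (n + 1)}
    (h : p < k) {γ : Family F X 1} (hγ : IsTrivialization τ (edge B b p k h.le) γ)
    (hp : ∀ {m : ℕ} (f : F _⦋m⦌), γ.app (SimplexCategory.const ⦋m⦌ ⦋1⦌ 0) f =
      α.app (SimplexCategory.const ⦋m⦌ ⦋n⦌ p) f) :
    ∃ β : Family F X n, IsTrivialization τ b β ∧
      (∀ {m : ℕ} (θ : ⦋m⦌ ⟶ ⦋1⦌) (f : F _⦋m⦌),
        β.app (θ ≫ SimplexCategory.mkOfLe p k h.le) f = γ.app θ f) ∧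
      ∀ {m : ℕ} (θ : ⦋m⦌ ⟶ ⦋n⦌), (∀ i, θ.toOrderHom i < k) → ∀ f : F _⦋m⦌,
        β.app θ f = α.app θ f := by
  have hα' := hα.pull (SimplexCategory.mkOfLe p k h.le)
  obtain ⟨H, hH, hHγ⟩ := hα'.exists_gauge hγ
  -- The gauge H over the edge p → k is spread over Δ[n] by collapsing the vertices below k to 0 and
  -- the others to 1. At 0 it is the identity, since α and γ agree at p.
  refine ⟨α.comp (H.pull (charMap k)), hα.comp (hH.pull _), fun {m} θ f => ?_,
    fun {m} θ hθ f => ?_⟩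
  · rw [Family.comp_app, Family.pull_app, Category.assoc, mkOfLe_comp_charMap h, Category.comp_id]
    exact hHγ θ f
  · rw [Family.comp_app, Family.pull_app, comp_charMap_of_lt θ hθ]
    congr 1
    apply hα'.injective (SimplexCategory.const ⦋m⦌ ⦋1⦌ 0)
    rw [hHγ, hp]
    rfl

end

/-! ### Lifting properties of the fibre and the base to the total space -/

section

variable {F X B : SSet.{u}} {τ : X ⟶ B}

theorem edge_congr_index {n : ℕ} (x : X _⦋n⦌) {i j i' j' : Fin (n + 1)} {h : i ≤ j} {h' : i' ≤ j'}
    (hi : i = i') (hj : j = j') : edge X x i j h = edge X x i' j' h' := by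
  subst hi hj
  rfl

theorem IsTrivialization.exists_app_id_eq {n : ℕ} {b : B _⦋n⦌} {α : Family F X n}
    (hα : IsTrivialization τ b α) {x : X _⦋n⦌} (hx : τ.app (op ⦋n⦌) x = b) :
    ∃ f, α.app (𝟙 _) f = x :=
  hα.exists_eq (𝟙 _) x (by simpa using hx)

theorem IsFibreBundle.isReduced (hτ : IsFibreBundle F τ) (hF : IsReduced F) (hB : IsReduced B) :
    IsReduced X := by
  obtain ⟨v, -⟩ := hB.exists
  obtain ⟨α, hα⟩ := hτ.exists_isTrivialization v
  obtain ⟨w, -⟩ := hF.exists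
  refine ⟨α.app (𝟙 _) w, trivial, fun x _ => ?_⟩
  obtain ⟨f, rfl⟩ := hα.exists_app_id_eq (hB.vertex_eq (τ.app _ x) v)
  rw [hF.vertex_eq f w]

theorem IsFibreBundle.isN (hτ : IsFibreBundle F τ) (hF : IsN F) (hB : IsN B) : IsN X := by
  intro n hn x y h
  have hb : τ.app (op ⦋n⦌) y = τ.app (op ⦋n⦌) x := hB n hn <| funext fun i => by
    rw [← app_enum, ← app_enum, h]
  obtain ⟨α, hα⟩ := hτ.exists_isTrivialization (τ.app (op ⦋n⦌) x)
  obtain ⟨f, rfl⟩ := hα.exists_app_id_eq rfl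
  obtain ⟨f', rfl⟩ := hα.exists_app_id_eq hb
  refine congrArg _ (hF.ext hn fun i => ?_)
  have := congrFun h i
  rw [enum_eq, enum_eq, α.edge_app, α.edge_app] at this
  exact hα.injective _ this

/-- A trivialization can be chosen to be constant along a tree of degenerate edges. -/
theorem IsFibreBundle.exists_constant_along (hτ : IsFibreBundle F τ) (hB : IsReduced B) {n : ℕ}
    (b : B _⦋n⦌) (p : Fin (n + 1) → Fin (n + 1)) (hp : ∀ k, p k ≤ k)
    (hb : ∀ k, IsOne B (edge B b (p k) k (hp k))) :
    ∃ α : Family F X n, IsTrivialization τ b α ∧ ∀ (k : Fin (n + 1)) (f : F _⦋1⦌),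
      α.app (SimplexCategory.mkOfLe (p k) k (hp k)) f =
        α.app (SimplexCategory.const ⦋1⦌ ⦋n⦌ (p k)) f := by
  suffices ∀ N : ℕ, ∃ α : Family F X n, IsTrivialization τ b α ∧
      ∀ k : Fin (n + 1), k.val < N → ∀ f : F _⦋1⦌,
        α.app (SimplexCategory.mkOfLe (p k) k (hp k)) f =
          α.app (SimplexCategory.const ⦋1⦌ ⦋n⦌ (p k)) f by
    obtain ⟨α, hα, h⟩ := this (n + 1)
    exact ⟨α, hα, fun k => h k k.isLt⟩
  intro N
  induction N with
  | zero =>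
    obtain ⟨α, hα⟩ := hτ.exists_isTrivialization b
    exact ⟨α, hα, fun k hk => absurd hk (Nat.not_lt_zero _)⟩
  | succ N ih =>
    obtain ⟨α, hα, h⟩ := ih
    by_cases hN : ∃ k : Fin (n + 1), k.val = N ∧ p k < k
    · obtain ⟨k, rfl, hpk⟩ := hN
      -- The edge from p k to k is degenerate, so the constant extension of α from the vertex p k
      -- trivializes the bundle over it.
      have hγ : IsTrivialization τ (edge B b (p k) k (hp k))
          (α.pull (SimplexCategory.const ⦋1⦌ ⦋n⦌ (p k))) := by
        rw [hB.one_eq (hb k) (isOne_map_const b (p k))]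
        exact hα.pull _
      obtain ⟨β, hβ, h₁, h₂⟩ := hα.exists_glue hpk hγ fun f => rfl
      refine ⟨β, hβ, fun j hj f => ?_⟩
      rcases Nat.lt_succ_iff_lt_or_eq.1 hj with hj | hj
      · rw [h₂, h₂, h j hj]
        · exact fun _ => (hp j).trans_lt hj
        · intro i
          refine lt_of_le_of_lt ?_ (show j < k from hj)
          fin_cases i
          · exact hp j
          · exact le_rfl
      · obtain rfl := Fin.ext hj
        rw [h₂ (SimplexCategory.const _ _ _) (fun _ => hpk)]
        have := h₁ (𝟙 _) f
        rwa [Category.id_comp] at this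
    · refine ⟨α, hα, fun j hj f => ?_⟩
      rcases Nat.lt_succ_iff_lt_or_eq.1 hj with hj | hj
      · exact h j hj f
      · have hpj : p j = j := le_antisymm (hp j) (not_lt.1 fun h' => hN ⟨j, hj, h'⟩)
        congr 1
        exact SimplexCategory.Hom.ext_one_left _ _ rfl hpj.symm

/-- Where α is constant along p → k, it carries the coordinate of that edge into X by its
restriction to the vertex p, which is injective and preserves units. -/
theorem Family.isOne_edge_iff {n : ℕ} {b : B _⦋n⦌} {α : Family F X n}
    (hα : IsTrivialization τ b α) (hF : IsReduced F) (hX : IsReduced X) {p k : Fin (n + 1)}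
    (hp : p ≤ k)
    (h : ∀ f : F _⦋1⦌, α.app (SimplexCategory.mkOfLe p k hp) f =
        α.app (SimplexCategory.const ⦋1⦌ ⦋n⦌ p) f) (y : F _⦋n⦌) :
    IsOne X (edge X (α.app (𝟙 _) y) p k hp) ↔ IsOne F (edge F y p k hp) := by
  have key : edge X (α.app (𝟙 _) y) p k hp =
      α.app (SimplexCategory.const ⦋1⦌ ⦋n⦌ p) (edge F y p k hp) := (α.edge_app _ _ _ _ _).trans (h _)
  rw [key]
  refine ⟨fun h' => ?_, α.isOne_app_const p⟩
  obtain ⟨e, he⟩ := hF.exists_one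
  rwa [hα.injective _ (hX.one_eq h' (α.isOne_app_const p he))]

/-- Each simplex extends along `ι` to a simplex for which the edges `p k → k` are degenerate. -/
def HasExtension (X : SSet.{u}) {m n : ℕ} (ι : ⦋m⦌ ⟶ ⦋n⦌) (p : Fin (n + 1) → Fin (n + 1))
    (hp : ∀ k, p k ≤ k) : Prop :=
  ∀ x : X _⦋m⦌, ∃ y : X _⦋n⦌, X.map ι.op y = x ∧ ∀ k, IsOne X (edge X y (p k) k (hp k))

/-- Extend first in B, trivialize over the extension constantly along the edges to be made units,
then extend the coordinate in F. -/
theorem IsFibreBundle.hasExtension (hτ : IsFibreBundle F τ) (hF : IsReduced F) (hB : IsReduced B)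
    {m n : ℕ} (ι : ⦋m⦌ ⟶ ⦋n⦌) (p : Fin (n + 1) → Fin (n + 1)) (hp : ∀ k, p k ≤ k)
    (h : HasExtension F ι p hp) (h' : HasExtension B ι p hp) : HasExtension X ι p hp := by
  intro x
  obtain ⟨b, hb, hb'⟩ := h' (τ.app (op ⦋m⦌) x)
  obtain ⟨α, hα, hαp⟩ := hτ.exists_constant_along hB b p hp hb'
  obtain ⟨f, rfl⟩ := hα.exists_eq ι x hb.symm
  obtain ⟨y, rfl, hy⟩ := h f
  refine ⟨α.app (𝟙 _) y, ?_, fun k => ?_⟩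
  · rw [α.map_app, Category.comp_id]
  · exact (Family.isOne_edge_iff hα hF (hτ.isReduced hF hB) (hp k) (hαp k) y).2 (hy k)

/-- An edge has at most one left inverse. -/
def UniqueInverse (X : SSet.{u}) : Prop :=
  ∀ x y : X _⦋2⦌, IsOne X (edge X x 0 2 (by decide)) → IsOne X (edge X y 0 2 (by decide)) →
    edge X x 1 2 (by decide) = edge X y 1 2 (by decide) → x = y

theorem IsFibreBundle.uniqueInverse (hτ : IsFibreBundle F τ) (hF : IsReduced F) (hB : IsReduced B)
    (h : UniqueInverse F) (h' : UniqueInverse B) : UniqueInverse X := by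
  intro x y hx hy hxy
  have hb : τ.app (op ⦋2⦌) y = τ.app (op ⦋2⦌) x := by
    refine h' _ _ ?_ ?_ ?_
    · rw [← app_edge]
      exact hy.app τ
    · rw [← app_edge]
      exact hx.app τ
    · rw [← app_edge, ← app_edge, hxy]
  -- Only the edge 0 → 2, a unit in B, imposes a condition; the other two entries are trivial.
  let p : Fin 3 → Fin 3 := ![0, 1, 0]
  have hp : ∀ k, p k ≤ k := by decide
  obtain ⟨α, hα, hαp⟩ := hτ.exists_constant_along hB (τ.app (op ⦋2⦌) x) p hp fun k => by
    fin_cases k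
    · exact isOne_edge_self _ _ _
    · exact isOne_edge_self _ _ _
    · have := hx.app τ
      rw [app_edge] at this
      exact this
  obtain ⟨f, rfl⟩ := hα.exists_app_id_eq rfl
  obtain ⟨f', rfl⟩ := hα.exists_app_id_eq hb
  have key := fun y => Family.isOne_edge_iff hα hF (hτ.isReduced hF hB) (hp 2) (hαp 2) y
  rw [h f f' ((key f).1 hx) ((key f').1 hy)]
  rw [α.edge_app, α.edge_app] at hxy
  exact hα.injective _ hxy

/-- The inclusion of the first half of `Δ[n + n]`. -/
def front (n : ℕ) : ⦋n⦌ ⟶ ⦋n + n⦌ :=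
  SimplexCategory.mkHom ⟨fun i => ⟨i.val, by omega⟩, fun _ _ h => h⟩

/-- The inclusion of the second half of `Δ[n + n]`. -/
def back (n : ℕ) : ⦋n⦌ ⟶ ⦋n + n⦌ :=
  SimplexCategory.mkHom ⟨fun i => ⟨n + i.val, by omega⟩, fun i j h => by
    have : i.val ≤ j.val := h
    simp only [Fin.mk_le_mk]
    omega⟩

/-- The reflection of the second half of `Δ[n + n]` onto the first. -/
def mirror (n : ℕ) (k : Fin (n + n + 1)) : Fin (n + n + 1) :=
  ⟨min k.val (n + n - k.val), by omega⟩

theorem mirror_le (n : ℕ) (k : Fin (n + n + 1)) : mirror n k ≤ k :=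
  min_le_left k.val _

theorem sandwich_le : ∀ k : Fin 4, (![0, 1, 0, 1] : Fin 4 → Fin 4) k ≤ k := by decide

/-- A characterization of inversions by the existence of extensions. -/
structure HasInverses (X : SSet.{u}) : Prop where
  mirror : ∀ n : ℕ, HasExtension X (back n) (mirror n) (mirror_le n)
  unique : UniqueInverse X
  sandwich : HasExtension X (SimplexCategory.mkOfLe (n := 3) 1 2 (by decide)) ![0, 1, 0, 1]
    sandwich_le

theorem IsFibreBundle.hasInverses (hτ : IsFibreBundle F τ) (hF : IsReduced F) (hB : IsReduced B)
    (h : HasInverses F) (h' : HasInverses B) : HasInverses X where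
  mirror n := hτ.hasExtension hF hB _ _ _ (h.mirror n) (h'.mirror n)
  unique := hτ.uniqueInverse hF hB h.unique h'.unique
  sandwich := hτ.hasExtension hF hB _ _ _ h.sandwich h'.sandwich

end

/-! ### An inversion yields the extension properties -/

namespace Inversion

variable {X : SSet.{u}}

/-- The inverse of a simplex. -/
def inv (I : Inversion X) {n : ℕ} (x : X _⦋n⦌) : X _⦋n⦌ :=
  SSet.opObjEquiv (I.ν.app (op ⦋n⦌) x)

theorem inv_map (I : Inversion X) {m n : ℕ} (u : ⦋m⦌ ⟶ ⦋n⦌) (x : X _⦋n⦌) :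
    I.inv (X.map u.op x) = X.map (SimplexCategory.rev.map u).op (I.inv x) :=
  app_map I.ν u x

theorem inv_inv (I : Inversion X) {n : ℕ} (x : X _⦋n⦌) : I.inv (I.inv x) = x :=
  congrArg (fun k => k.app (op ⦋n⦌) x) I.involutive

theorem edge_inv_map (I : Inversion X) {m n : ℕ} (u : ⦋m⦌ ⟶ ⦋n⦌) (x : X _⦋n⦌)
    (i j : Fin (m + 1)) (h : i ≤ j) :
    edge X (I.inv (X.map u.op x)) i j h = edge X (I.inv x) (u.toOrderHom i.rev).rev
      (u.toOrderHom j.rev).rev (by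
        rw [Fin.rev_le_rev]
        exact u.toOrderHom.monotone (by rwa [Fin.rev_le_rev])) := by
  rw [inv_map, edge_map]
  rfl

theorem exists_concat (I : Inversion X) {n : ℕ} (hn : 1 ≤ n) (x : X _⦋n⦌) :
    ∃ y : X _⦋n + n⦌, (∀ i : Fin n, enum X y (Fin.castAdd n i) = enum X (I.inv x) i) ∧
      (∀ i : Fin n, enum X y (Fin.natAdd n i) = enum X x i) ∧ IsOne X (total X y) := by
  obtain ⟨e, he, y, hy, rfl⟩ := I.left_inv n hn x
  refine ⟨y, fun i => ?_, fun i => ?_, he⟩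
  · rw [hy, Fin.append_left]
    rfl
  · rw [hy, Fin.append_right]

/-- The inclusion of the middle part of `Δ[n + n]`. -/
def middle (i d : ℕ) : ⦋i + i⦌ ⟶ ⦋(d + i) + (d + i)⦌ :=
  SimplexCategory.mkHom ⟨fun j => ⟨d + j.val, by omega⟩, fun j k h => by
    have : j.val ≤ k.val := h
    simp only [Fin.mk_le_mk]
    omega⟩

/-- The inclusion of the initial part of `Δ[n]`. -/
def initial (i d : ℕ) : ⦋i⦌ ⟶ ⦋d + i⦌ :=
  SimplexCategory.mkHom ⟨fun j => ⟨j.val, by omega⟩, fun _ _ h => h⟩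

/-- With n = d + i, the edge n - i → n + i of [ν x|x] is the product of [ν x'|x'], where x' is the
initial i-dimensional part of x: by the N-property the latter simplex is the middle part of the
former. -/
theorem isOne_edge_concat (I : Inversion X) (hN : IsN X) (i d : ℕ) (x : X _⦋d + i⦌)
    (y : X _⦋(d + i) + (d + i)⦌)
    (h₁ : ∀ k : Fin (d + i), enum X y (Fin.castAdd (d + i) k) = enum X (I.inv x) k)
    (h₂ : ∀ k : Fin (d + i), enum X y (Fin.natAdd (d + i) k) = enum X x k) :
    IsOne X (edge X y ⟨d, by omega⟩ ⟨d + i + i, by omega⟩ (by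
      simp only [Fin.mk_le_mk]
      omega)) := by
  rcases Nat.eq_zero_or_pos i with rfl | hi
  · exact isOne_edge_self _ _ _
  obtain ⟨z, hz₁, hz₂, hz⟩ := I.exists_concat hi (X.map (initial i d).op x)
  have key : z = X.map (middle i d).op y := by
    refine hN.ext (by omega) fun k => ?_
    rw [edge_map, ← enum_eq]
    refine Fin.addCases (fun k => ?_) (fun k => ?_) k
    · rw [hz₁, enum_eq, edge_inv_map]
      have := h₁ ⟨d + k.val, by omega⟩
      rw [enum_eq, enum_eq] at this
      refine Eq.trans ?_ (this.symm.trans ?_)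
      · refine edge_congr_index _ (Fin.ext ?_) (Fin.ext ?_)
        · change d + i + 1 - ((i + 1 - (k.val + 1)) + 1) = d + k.val
          omega
        · change d + i + 1 - ((i + 1 - (k.val + 1 + 1)) + 1) = d + k.val + 1
          omega
      · exact edge_congr_index _ (Fin.ext rfl) (Fin.ext rfl)
    · rw [hz₂, enum_eq, edge_map]
      have := h₂ ⟨k.val, by omega⟩
      rw [enum_eq, enum_eq] at this
      refine Eq.trans ?_ (this.symm.trans ?_)
      · exact edge_congr_index _ (Fin.ext rfl) (Fin.ext rfl)
      · refine edge_congr_index _ (Fin.ext ?_) (Fin.ext ?_)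
        · exact Nat.add_assoc d i k.val
        · exact congrArg (· + 1) (Nat.add_assoc d i k.val)
  rw [key, total_eq, edge_map] at hz
  convert hz using 2
  · exact Fin.ext rfl
  · exact Fin.ext (Nat.add_assoc d i i)

theorem exists_mirror (I : Inversion X) (hN : IsN X) {n : ℕ} (hn : 1 ≤ n) (x : X _⦋n⦌) :
    ∃ y : X _⦋n + n⦌, X.map (front n).op y = I.inv x ∧ X.map (back n).op y = x ∧
      ∀ k, IsOne X (edge X y (mirror n k) k (mirror_le n k)) := by
  obtain ⟨y, h₁, h₂, -⟩ := I.exists_concat hn x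
  refine ⟨y, hN.ext hn fun i => ?_, hN.ext hn fun i => ?_, fun k => ?_⟩
  · rw [← enum_eq, ← enum_eq, ← h₁, enum_eq, enum_eq, edge_map]
    rfl
  · rw [← enum_eq, ← enum_eq, ← h₂, enum_eq, enum_eq, edge_map]
    rfl
  · by_cases hk : k.val ≤ n
    · have : mirror n k = k := by
        ext
        simp only [mirror]
        omega
      convert isOne_edge_self y k le_rfl
    · obtain ⟨i, d, rfl, hi⟩ : ∃ i d, d + i = n ∧ k.val = n + i :=
        ⟨k.val - n, n - (k.val - n), by omega, by omega⟩
      convert isOne_edge_concat I hN i d x y h₁ h₂ using 2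
      · ext
        simp only [mirror]
        omega
      · ext
        simp only
        omega

/-- If u = [y|x] has product 1, then [u|ν u] = [y|x|ν x|ν y] is a simplex in which yx and x·ν x are
units. Its edge 0 → 3 therefore equals both y and ν x. -/
theorem eq_inv (I : Inversion X) (hX : IsReduced X) (hN : IsN X) (u : X _⦋2⦌)
    (hu : IsOne X (edge X u 0 2 (by decide))) :
    edge X u 0 1 (by decide) = I.inv (edge X u 1 2 (by decide)) := by
  obtain ⟨v, h₁, h₂, h₃⟩ := I.exists_mirror hN (by norm_num) (I.inv u)
  rw [I.inv_inv] at h₁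
  have h13 : IsOne X (edge X v (n := 4) 1 3 (by decide)) := h₃ 3
  have h02 : IsOne X (edge X v (n := 4) 0 2 (by decide)) := by
    rw [← h₁, edge_map] at hu
    exact hu
  have h01 : edge X v (n := 4) 0 1 (by decide) = edge X u 0 1 (by decide) := by
    rw [← h₁, edge_map]
    rfl
  have h23 : edge X v (n := 4) 2 3 (by decide) = I.inv (edge X u 1 2 (by decide)) := by
    have : edge X (I.inv u) 0 1 (by decide) = I.inv (edge X u 1 2 (by decide)) := by
      rw [edge, edge, inv_map]
      exact congrArg (fun v : ⦋1⦌ ⟶ ⦋2⦌ => X.map v.op (I.inv u))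
        (SimplexCategory.Hom.ext_one_left _ _)
    rw [← this, ← h₂, edge_map]
    rfl
  rw [← h01, ← h23,
    ← edge_eq_of_isOne_left hX hN v (i := (0 : Fin 5)) (j := 2) (k := 3) (by decide) (by decide) h02,
    ← edge_eq_of_isOne_right hX hN v (i := (0 : Fin 5)) (j := 1) (k := 3) (by decide) (by decide)
      h13]

theorem uniqueInverse (I : Inversion X) (hX : IsReduced X) (hN : IsN X) : UniqueInverse X := by
  intro x y hx hy h
  refine hN.ext_two ?_ h
  rw [I.eq_inv hX hN x hx, I.eq_inv hX hN y hy, h]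

theorem hasInverses (I : Inversion X) (hX : IsReduced X) (hN : IsN X) : HasInverses X where
  mirror n x := by
    rcases Nat.eq_zero_or_pos n with rfl | hn
    · refine ⟨x, hX.vertex_eq _ _, fun k => ?_⟩
      convert isOne_edge_self x k le_rfl
      exact Subsingleton.elim (α := Fin 1) _ _
    · obtain ⟨y, -, h⟩ := I.exists_mirror hN hn x
      exact ⟨y, h⟩
  unique := I.uniqueInverse hX hN
  sandwich x := by
    -- Here u = [x|x⁻¹] and v = [x|x⁻¹|x|x⁻¹]; dropping the first vertex of v leaves the sandwich
    -- [x⁻¹|x|x⁻¹].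
    obtain ⟨u, -, hu, hu'⟩ := I.exists_mirror hN le_rfl (I.inv x)
    obtain ⟨v, -, hv, hv'⟩ := I.exists_mirror hN (by norm_num) (show X _⦋2⦌ from u)
    have hv13 : IsOne X (edge X v (n := 4) 1 3 (by decide)) := hv' 3
    have huo : IsOne X (edge X (show X _⦋2⦌ from u) 0 2 (by decide)) := hu' 2
    have hu12 : edge X (show X _⦋2⦌ from u) 1 2 (by decide) = I.inv x := by
      rw [← hu, ← edge_self_one (X.map (back 1).op u), edge_map]
      rfl
    have hu01 : edge X (show X _⦋2⦌ from u) 0 1 (by decide) = x := by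
      rw [I.eq_inv hX hN _ huo, hu12, I.inv_inv]
    have hv23 : edge X v (n := 4) 2 3 (by decide) = x := by
      rw [← hu01, ← hv, edge_map]
      rfl
    have hv24 : IsOne X (edge X v (n := 4) 2 4 (by decide)) := by
      rw [← hv, edge_map] at huo
      exact huo
    let s : ⦋3⦌ ⟶ ⦋4⦌ := SimplexCategory.δ 0
    refine ⟨X.map s.op v, ?_, fun k => ?_⟩
    · change edge X _ _ _ _ = x
      rw [edge_map]
      exact hv23
    · rw [edge_map]
      fin_cases k
      · exact isOne_edge_self _ _ _
      · exact isOne_edge_self _ _ _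
      · exact hv13
      · exact hv24

end Inversion

/-! ### The extension properties yield an inversion -/

namespace HasInverses

variable {X : SSet.{u}}

/-- `y` is the left inverse of `x`. -/
def LeftInv (X : SSet.{u}) (y x : X _⦋1⦌) : Prop :=
  ∃ u : X _⦋2⦌, edge X u 0 1 (by decide) = y ∧ edge X u 1 2 (by decide) = x ∧
    IsOne X (edge X u 0 2 (by decide))

theorem leftInv_unique (h : HasInverses X) {x y y' : X _⦋1⦌} (hy : LeftInv X y x)
    (hy' : LeftInv X y' x) : y = y' := by
  obtain ⟨u, rfl, rfl, hu⟩ := hy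
  obtain ⟨u', rfl, hx, hu'⟩ := hy'
  rw [h.unique u u' hu hu' hx.symm]

/-- In the sandwich [y|x|y'] both yx and xy' are units, so y and y' both equal the edge 0 → 3. This
makes the left inverse y a right inverse. -/
theorem leftInv_symm (h : HasInverses X) (hX : IsReduced X) (hN : IsN X) {x y : X _⦋1⦌}
    (hy : LeftInv X y x) : LeftInv X x y := by
  obtain ⟨w, hw, hw'⟩ := h.sandwich x
  have h02 : IsOne X (edge X w 0 2 (by decide)) := hw' 2
  have h13 : IsOne X (edge X w 1 3 (by decide)) := hw' 3
  have hw : edge X w 1 2 (by decide) = x := hw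
  have h01 : edge X w 0 1 (by decide) = y := h.leftInv_unique
    ⟨face X w 0 1 2 (by decide) (by decide), edge_face_zero_one .., edge_face_one_two .., by
      rwa [edge_face_zero_two]⟩ (hw ▸ hy)
  refine ⟨face X w 1 2 3 (by decide) (by decide), ?_, ?_, ?_⟩
  · rw [edge_face_zero_one, hw]
  · rw [edge_face_one_two, ← h01,
      ← edge_eq_of_isOne_left hX hN w (i := 0) (j := 2) (k := 3) (by decide) (by decide) h02,
      ← edge_eq_of_isOne_right hX hN w (i := 0) (j := 1) (k := 3) (by decide) (by decide) h13]
  · rwa [edge_face_zero_two]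

/-- The inverse of a simplex, as half of a mirror-symmetric simplex. -/
noncomputable def inv (h : HasInverses X) {n : ℕ} (x : X _⦋n⦌) : X _⦋n⦌ :=
  X.map (front n).op (h.mirror n x).choose

/-- In the mirror-symmetric simplex consider the triangle n - j → n - i → n + j. Its long edge is a
unit, and its second edge equals n + i → n + j, an edge of x, because n - i → n + i is a unit. -/
theorem leftInv_edge_inv (h : HasInverses X) (hX : IsReduced X) (hN : IsN X) {n : ℕ} (x : X _⦋n⦌)
    (i j : Fin (n + 1)) (hij : i ≤ j) :
    LeftInv X (edge X (h.inv x) j.rev i.rev (Fin.rev_le_rev.2 hij)) (edge X x i j hij) := by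
  obtain ⟨hy, hy'⟩ := (h.mirror n x).choose_spec
  unfold inv
  set y := (h.mirror n x).choose
  have hij' : i.val ≤ j.val := hij
  have hi := hy' ⟨n + i.val, by omega⟩
  have hj := hy' ⟨n + j.val, by omega⟩
  have ei : PartialGroups.mirror n ⟨n + i.val, by omega⟩ = ⟨n - i.val, by omega⟩ := by
    ext
    simp only [PartialGroups.mirror]
    omega
  have ej : PartialGroups.mirror n ⟨n + j.val, by omega⟩ = ⟨n - j.val, by omega⟩ := by
    ext
    simp only [PartialGroups.mirror]
    omega
  rw [edge_congr_index y ei rfl (h' := by simp only [Fin.mk_le_mk]; omega)] at hi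
  rw [edge_congr_index y ej rfl (h' := by simp only [Fin.mk_le_mk]; omega)] at hj
  refine ⟨face X y ⟨n - j.val, by omega⟩ ⟨n - i.val, by omega⟩ ⟨n + j.val, by omega⟩
    (by simp only [Fin.mk_le_mk]; omega) (by simp only [Fin.mk_le_mk]; omega), ?_, ?_, ?_⟩
  · rw [edge_face_zero_one, edge_map]
    exact edge_congr_index _ (Fin.ext (Nat.add_sub_add_right n 1 j.val).symm)
      (Fin.ext (Nat.add_sub_add_right n 1 i.val).symm)
  · rw [edge_face_one_two, edge_eq_of_isOne_left hX hN y (j := ⟨n + i.val, by omega⟩) _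
      (by simp only [Fin.mk_le_mk]; omega) hi, ← hy, edge_map]
    rfl
  · rwa [edge_face_zero_two]

/-- Inverses of simplices are detected on edges; naturality and involutivity of the inversion both
reduce to this. -/
theorem eq_inv (h : HasInverses X) (hX : IsReduced X) (hN : IsN X) {n : ℕ} (x y : X _⦋n⦌)
    (hxy : ∀ i : Fin n, LeftInv X (edge X y i.rev.castSucc i.rev.succ i.rev.castSucc_le_succ)
      (edge X x i.castSucc i.succ i.castSucc_le_succ)) : y = h.inv x := by
  rcases Nat.eq_zero_or_pos n with rfl | hn
  · exact hX.vertex_eq _ _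
  refine hN.ext hn fun i => ?_
  have h₁ := hxy i.rev
  rw [edge_congr_index y (congrArg Fin.castSucc (Fin.rev_rev i)) (congrArg Fin.succ (Fin.rev_rev i))
    (h' := i.castSucc_le_succ)] at h₁
  have h₂ := h.leftInv_edge_inv hX hN x i.rev.castSucc i.rev.succ i.rev.castSucc_le_succ
  rw [edge_congr_index (h.inv x) (i' := i.castSucc) (j' := i.succ)
    (by rw [Fin.rev_succ, Fin.rev_rev]) (by rw [Fin.rev_castSucc, Fin.rev_rev])
    (h' := i.castSucc_le_succ)] at h₂
  exact h.leftInv_unique h₁ h₂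

theorem inv_map (h : HasInverses X) (hX : IsReduced X) (hN : IsN X) {m n : ℕ} (u : ⦋m⦌ ⟶ ⦋n⦌)
    (x : X _⦋n⦌) : h.inv (X.map u.op x) = X.map (SimplexCategory.rev.map u).op (h.inv x) := by
  symm
  refine h.eq_inv hX hN _ _ fun i => ?_
  rw [edge_map, edge_map]
  convert h.leftInv_edge_inv hX hN x (u.toOrderHom i.castSucc) (u.toOrderHom i.succ)
    (u.toOrderHom.monotone i.castSucc_le_succ) using 2
  · rw [← Fin.rev_succ]
    exact congrArg (fun j => (u.toOrderHom j).rev) (Fin.rev_rev _)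
  · rw [← Fin.rev_castSucc]
    exact congrArg (fun j => (u.toOrderHom j).rev) (Fin.rev_rev _)

theorem inv_inv (h : HasInverses X) (hX : IsReduced X) (hN : IsN X) {n : ℕ} (x : X _⦋n⦌) :
    h.inv (h.inv x) = x := by
  symm
  refine h.eq_inv hX hN _ _ fun i => h.leftInv_symm hX hN ?_
  convert h.leftInv_edge_inv hX hN x i.rev.castSucc i.rev.succ i.rev.castSucc_le_succ using 2
  · rw [Fin.rev_succ, Fin.rev_rev]
  · rw [Fin.rev_castSucc, Fin.rev_rev]

/-- The inversion determined by mirror-symmetric extensions. -/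
noncomputable def inversion (h : HasInverses X) (hX : IsReduced X) (hN : IsN X) : Inversion X where
  ν :=
    { app := fun n => ↾fun x => SSet.opObjEquiv.symm (h.inv (n := n.unop.len) x)
      naturality := fun n m u => by
        ext x
        exact h.inv_map hX hN (m := m.unop.len) (n := n.unop.len) u.unop x }
  involutive := by
    ext n x
    exact h.inv_inv hX hN (n := n.unop.len) x
  left_inv n hn x := by
    obtain ⟨hy, hy'⟩ := (h.mirror n x).choose_spec
    refine ⟨_, ?_, (h.mirror n x).choose, funext fun k => ?_, rfl⟩
    · rw [total_eq]
      convert hy' (Fin.last _) using 2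
      ext
      simp [PartialGroups.mirror]
    · refine Fin.addCases (fun k => ?_) (fun k => ?_) k
      · rw [Fin.append_left]
        change _ = enum X (h.inv x) k
        rw [enum_eq, enum_eq, inv, edge_map]
        rfl
      · rw [Fin.append_right, enum_eq, enum_eq]
        conv_rhs => rw [← hy]
        rw [edge_map]
        rfl

end HasInverses

theorem isPartialGroup_iff {X : SSet.{u}} :
    IsPartialGroup X ↔ IsReduced X ∧ IsN X ∧ HasInverses X :=
  ⟨fun ⟨h, h', ⟨I⟩⟩ => ⟨h, h', I.hasInverses h h'⟩, fun ⟨h, h', H⟩ => ⟨h, h', ⟨H.inversion h h'⟩⟩⟩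

theorem IsFibreBundle.isPartialGroup {F X B : SSet.{u}} {τ : X ⟶ B} (hτ : IsFibreBundle F τ)
    (hF : IsPartialGroup F) (hB : IsPartialGroup B) : IsPartialGroup X := by
  obtain ⟨hF, hF', hF''⟩ := isPartialGroup_iff.1 hF
  obtain ⟨hB, hB', hB''⟩ := isPartialGroup_iff.1 hB
  exact isPartialGroup_iff.2 ⟨hτ.isReduced hF hB, hτ.isN hF' hB', hτ.hasInverses hF hB hF'' hB''⟩

/-! ### Gauges over Δ[1]: homotopies and the normalizer -/

section

variable {F X : SSet.{u}}

theorem predAbove_val {n : ℕ} (i : Fin n) (j : Fin (n + 1)) :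
    (i.predAbove j).val = if i.val < j.val then j.val - 1 else j.val := by
  have key : i.castSucc < j ↔ i.val < j.val := Iff.rfl
  by_cases h : i.castSucc < j
  · rw [Fin.predAbove_of_castSucc_lt i j h, if_pos (key.1 h), Fin.val_pred]
  · rw [Fin.predAbove_of_le_castSucc i j (not_lt.1 h), if_neg (fun h' => h (key.2 h'))]
    rfl

theorem Family.edge_app_eq {n m : ℕ} (α : Family F X n) (θ : ⦋m⦌ ⟶ ⦋n⦌) (f : F _⦋m⦌)
    {i j : Fin (m + 1)} (h : i ≤ j) {a b : Fin (n + 1)} (ha : θ.toOrderHom i = a)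
    (hb : θ.toOrderHom j = b) :
    edge X (α.app θ f) i j h = α.app (SimplexCategory.mkOfLe a b
      (ha ▸ hb ▸ θ.toOrderHom.monotone h)) (edge F f i j h) := by
  subst ha hb
  exact α.edge_app θ f i j h

theorem edge_map_eq {m n : ℕ} (u : ⦋m⦌ ⟶ ⦋n⦌) (x : X _⦋n⦌) {i j : Fin (m + 1)} (h : i ≤ j)
    {a b : Fin (n + 1)} (ha : u.toOrderHom i = a) (hb : u.toOrderHom j = b) :
    edge X (X.map u.op x) i j h = edge X x a b (ha ▸ hb ▸ u.toOrderHom.monotone h) := by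
  subst ha hb
  exact edge_map u x i j h

theorem edge_eq_one (hX : IsReduced X) {e : X _⦋1⦌} (he : IsOne X e) {n : ℕ} (x : X _⦋n⦌)
    (i : Fin (n + 1)) : edge X x i i le_rfl = e :=
  hX.one_eq (isOne_edge_self x i le_rfl) he

end

namespace Family

variable {F : SSet.{u}} {H : Family F F 1}

/-- H maps the square v × Δ[1] to F. This is one of its two triangles, with diagonal the value of H
on v over 0 → 1; `isProd_one_vertex` is the other. -/
theorem isProd_vertex_one (hF : IsReduced F) {e : F _⦋1⦌} (he : IsOne F e)
    (H : Family F F 1) (v : F _⦋1⦌) :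
    IsProd F ![H.app (SimplexCategory.const ⦋1⦌ ⦋1⦌ 0) v,
      H.app (SimplexCategory.mkOfLe 0 1 (by decide)) e]
      (H.app (SimplexCategory.mkOfLe 0 1 (by decide)) v) := by
  rw [isProd_two_iff]
  refine ⟨H.app (charMap (n := 2) 2) (F.map (charMap (n := 2) 1).op v), ?_, ?_, ?_⟩
  · rw [H.edge_app_eq _ _ _ (a := 0) (b := 0) rfl rfl,
      edge_map_eq (charMap 1) v _ (a := 0) (b := 1) rfl rfl, edge_self_one,
      SimplexCategory.mkOfLe_refl]
  · rw [H.edge_app_eq _ _ _ (a := 0) (b := 1) rfl rfl,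
      edge_map_eq (charMap 1) v _ (a := 1) (b := 1) rfl rfl, edge_eq_one hF he]
  · rw [H.edge_app_eq _ _ _ (a := 0) (b := 1) rfl rfl,
      edge_map_eq (charMap 1) v _ (a := 0) (b := 1) rfl rfl, edge_self_one]

theorem isProd_one_vertex (hF : IsReduced F) {e : F _⦋1⦌} (he : IsOne F e)
    (H : Family F F 1) (v : F _⦋1⦌) :
    IsProd F ![H.app (SimplexCategory.mkOfLe 0 1 (by decide)) e,
      H.app (SimplexCategory.const ⦋1⦌ ⦋1⦌ 1) v]
      (H.app (SimplexCategory.mkOfLe 0 1 (by decide)) v) := by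
  rw [isProd_two_iff]
  refine ⟨H.app (charMap (n := 2) 1) (F.map (charMap (n := 2) 2).op v), ?_, ?_, ?_⟩
  · rw [H.edge_app_eq _ _ _ (a := 0) (b := 1) rfl rfl,
      edge_map_eq (charMap 2) v _ (a := 0) (b := 0) rfl rfl, edge_eq_one hF he]
  · rw [H.edge_app_eq _ _ _ (a := 1) (b := 1) rfl rfl,
      edge_map_eq (charMap 2) v _ (a := 0) (b := 1) rfl rfl, edge_self_one,
      SimplexCategory.mkOfLe_refl]
  · rw [H.edge_app_eq _ _ _ (a := 0) (b := 1) rfl rfl,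
      edge_map_eq (charMap 2) v _ (a := 0) (b := 1) rfl rfl, edge_self_one]

theorem isProd_vertex_one_iff (hF : IsReduced F) (hN : IsN F) {e : F _⦋1⦌} (he : IsOne F e)
    (H : Family F F 1) (v z : F _⦋1⦌) :
    IsProd F ![H.app (SimplexCategory.const ⦋1⦌ ⦋1⦌ 0) v,
      H.app (SimplexCategory.mkOfLe 0 1 (by decide)) e] z ↔
      z = H.app (SimplexCategory.mkOfLe 0 1 (by decide)) v := by
  refine ⟨fun h => hN.isProd_two_unique h (isProd_vertex_one hF he H v), ?_⟩
  rintro rfl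
  exact isProd_vertex_one hF he H v

/-- In a partial group the existence of the word [x|y|z] is stronger than that of [x|yz]. Here they
are equivalent because H is invertible: the last edge can be split off after undoing H. -/
theorem IsGauge.isProd_three_iff (hH : H.IsGauge) (hF : IsReduced F) (hN : IsN F) {e : F _⦋1⦌}
    (he : IsOne F e) (x v z : F _⦋1⦌) :
    IsProd F ![x, H.app (SimplexCategory.const ⦋1⦌ ⦋1⦌ 0) v,
      H.app (SimplexCategory.mkOfLe 0 1 (by decide)) e] z ↔
    IsProd F ![x, H.app (SimplexCategory.mkOfLe 0 1 (by decide)) v] z := by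
  rw [PartialGroups.isProd_three_iff, isProd_two_iff]
  constructor
  · rintro ⟨d, rfl, h₁, h₂, rfl⟩
    refine ⟨face F d 0 1 3 (by decide) (by decide), edge_face_zero_one .., ?_,
      edge_face_zero_two ..⟩
    rw [edge_face_one_two, ← isProd_vertex_one_iff hF hN he, isProd_two_iff]
    exact ⟨face F d 1 2 3 (by decide) (by decide), by rw [edge_face_zero_one, h₁],
      by rw [edge_face_one_two, h₂], edge_face_zero_two ..⟩
  · rintro ⟨y, rfl, hy, rfl⟩
    obtain ⟨H', h₁, h₂⟩ := hH.exists_inv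
    -- Undo H with the last vertex of y over 1, repeat that vertex, and apply H with only the new
    -- copy over 1. The repeated edge becomes the value of H at the unit.
    refine ⟨H.app (charMap (n := 3) 3) (F.map (SimplexCategory.σ 2).op
      (H'.app (charMap (n := 2) 2) y)), ?_, ?_, ?_, ?_⟩
    · rw [H.edge_app_eq _ _ _ (a := 0) (b := 0) rfl rfl,
        edge_map_eq (SimplexCategory.σ 2) _ _ (a := 0) (b := 1) rfl rfl,
        H'.edge_app_eq _ _ _ (a := 0) (b := 0) rfl rfl, h₂]
    · rw [H.edge_app_eq _ _ _ (a := 0) (b := 0) rfl rfl,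
        edge_map_eq (SimplexCategory.σ 2) _ _ (a := 1) (b := 2) rfl rfl,
        H'.edge_app_eq _ _ _ (a := 0) (b := 1) rfl rfl, hy, h₁, SimplexCategory.mkOfLe_refl]
    · rw [H.edge_app_eq _ _ _ (a := 0) (b := 1) rfl rfl,
        edge_map_eq (SimplexCategory.σ 2) _ _ (a := 2) (b := 2) rfl rfl, edge_eq_one hF he]
    · rw [H.edge_app_eq _ _ _ (a := 0) (b := 1) rfl rfl,
        edge_map_eq (SimplexCategory.σ 2) _ _ (a := 0) (b := 2) rfl rfl,
        H'.edge_app_eq _ _ _ (a := 0) (b := 1) rfl rfl, h₂]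

/-- The value of a gauge over `Δ[1]` on the unit, over the non-degenerate edge, is in the
normalizer. -/
theorem IsGauge.isNormalizing (hH : H.IsGauge) (hF : IsReduced F) {e : F _⦋1⦌}
    (he : IsOne F e) :
    IsNormalizing F (H.app (SimplexCategory.mkOfLe 0 1 (by decide)) e) := by
  obtain ⟨φ₀, hφ₀⟩ := hH.exists_iso 0
  obtain ⟨φ₁, hφ₁⟩ := hH.exists_iso 1
  obtain ⟨H', h₁, h₂⟩ := hH.exists_inv
  have hinv : ∀ {n : ℕ} (x : F _⦋n⦌),
      H.app (SimplexCategory.const ⦋n⦌ ⦋1⦌ 1) (φ₁.inv.app (op ⦋n⦌) x) = x := fun {n} x => by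
    rw [← hφ₁]
    exact congrArg (fun k => k.app (op ⦋n⦌) x) φ₁.inv_hom_id
  have hact : ∀ x : F _⦋1⦌, act (φ₁.symm ≪≫ φ₀) x =
      H.app (SimplexCategory.const ⦋1⦌ ⦋1⦌ 0) (φ₁.inv.app (op ⦋1⦌) x) := fun x => hφ₀ _
  -- Conjugation by η is φ₀ ∘ φ₁⁻¹, where φ₀ and φ₁ are the ends of H. The inverse of η is φ₀
  -- applied to the edge that H sends to the unit over 0 → 1.
  refine ⟨φ₁.symm ≪≫ φ₀, ⟨H.app (SimplexCategory.const ⦋1⦌ ⦋1⦌ 0)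
    (H'.app (SimplexCategory.mkOfLe 0 1 (by decide)) e), ⟨e, he, ?_⟩, fun x => ?_⟩, fun n x => ?_⟩
  · have := isProd_vertex_one hF he H (H'.app (SimplexCategory.mkOfLe 0 1 (by decide)) e)
    rwa [h₂] at this
  · rw [PartialGroups.isProd_three_iff, hact]
    generalize hv : φ₁.inv.app (op ⦋1⦌) x = v
    obtain ⟨y, hy₁, hy₂, hy₃⟩ := isProd_two_iff.1 (isProd_one_vertex hF he H v)
    -- Start from the triangle [η|x], repeat its last vertex, undo H with the new vertex over 1 and
    -- apply H over 0. The last edge becomes η' and the product becomes φ₀(v).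
    refine ⟨H.app (SimplexCategory.const ⦋3⦌ ⦋1⦌ 0) (H'.app (charMap (n := 3) 3)
      (F.map (SimplexCategory.σ 2).op y)), ?_, ?_, ?_, ?_⟩
    · rw [H.edge_app_eq _ _ _ (a := 0) (b := 0) rfl rfl,
        H'.edge_app_eq _ _ _ (a := 0) (b := 0) rfl rfl,
        edge_map_eq (SimplexCategory.σ 2) _ _ (a := 0) (b := 1) rfl rfl, hy₁, h₂]
    · rw [H.edge_app_eq _ _ _ (a := 0) (b := 0) rfl rfl,
        H'.edge_app_eq _ _ _ (a := 0) (b := 0) rfl rfl,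
        edge_map_eq (SimplexCategory.σ 2) _ _ (a := 1) (b := 2) rfl rfl, hy₂, h₂, ← hv, hinv]
    · rw [H.edge_app_eq _ _ _ (a := 0) (b := 0) rfl rfl,
        H'.edge_app_eq _ _ _ (a := 0) (b := 1) rfl rfl,
        edge_map_eq (SimplexCategory.σ 2) _ _ (a := 2) (b := 2) rfl rfl, edge_eq_one hF he,
        SimplexCategory.mkOfLe_refl]
    · rw [H.edge_app_eq _ _ _ (a := 0) (b := 0) rfl rfl,
        H'.edge_app_eq _ _ _ (a := 0) (b := 1) rfl rfl,
        edge_map_eq (SimplexCategory.σ 2) _ _ (a := 0) (b := 2) rfl rfl, hy₃, h₁,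
        SimplexCategory.mkOfLe_refl]
  · set v := φ₁.inv.app (op ⦋n⦌) x with hv
    -- These are the top simplices of the prism v × Δ[1], crossing from 0 to 1 at the vertex i. The
    -- crossing edge is η, and all share the same long edge.
    refine ⟨H.app (SimplexCategory.mkOfLe 0 1 (by decide)) (total F v), fun i =>
      ⟨H.app (charMap (n := n + 1) i.succ) (F.map (SimplexCategory.σ i).op v), ?_, ?_⟩⟩
    · funext j
      rw [enum_eq]
      rcases Fin.eq_self_or_eq_succAbove i j with rfl | ⟨j, rfl⟩
      · rw [Fin.insertNth_apply_same, H.edge_app_eq _ _ _ (a := 0) (b := 1)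
          (charMap_of_lt j.castSucc_lt_succ) (charMap_of_le le_rfl),
          edge_map_eq (SimplexCategory.σ j) _ _ (a := j) (b := j)
          (Fin.predAbove_castSucc_self j) (Fin.predAbove_succ_self j), edge_eq_one hF he]
      · rw [Fin.insertNth_apply_succAbove]
        have hs : (i.succAbove j).val = if j.val < i.val then j.val else j.val + 1 := by
          unfold Fin.succAbove
          split_ifs <;> simp_all [Fin.lt_def]
        have hσ₁ : (SimplexCategory.σ i).toOrderHom (i.succAbove j).castSucc = j.castSucc := by
          refine Fin.ext ((predAbove_val _ _).trans ?_)
          rw [Fin.val_castSucc, Fin.val_castSucc, hs]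
          split_ifs <;> omega
        have hσ₂ : (SimplexCategory.σ i).toOrderHom (i.succAbove j).succ = j.succ := by
          refine Fin.ext ((predAbove_val _ _).trans ?_)
          rw [Fin.val_succ, Fin.val_succ, hs]
          split_ifs <;> omega
        have hj' : j.castSucc < i ↔ j.val < i.val := Iff.rfl
        split_ifs with hj
        · rw [H.edge_app_eq _ _ _ (a := 0) (b := 0) (charMap_of_lt ?_) (charMap_of_lt ?_),
            edge_map_eq (SimplexCategory.σ i) _ _ hσ₁ hσ₂, hact, hv, ← app_edge, ← enum_eq,
            SimplexCategory.mkOfLe_refl]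
          all_goals
            rw [Fin.lt_def]
            simp only [Fin.val_succ, Fin.val_castSucc, hs, if_pos (hj'.1 hj)]
            have := hj'.1 hj
            omega
        · rw [H.edge_app_eq _ _ _ (a := 1) (b := 1) (charMap_of_le ?_) (charMap_of_le ?_),
            edge_map_eq (SimplexCategory.σ i) _ _ hσ₁ hσ₂, hv, ← app_edge, ← enum_eq,
            SimplexCategory.mkOfLe_refl, hinv]
          all_goals
            rw [Fin.le_def]
            simp only [Fin.val_succ, Fin.val_castSucc, hs, if_neg (fun h => hj (hj'.2 h))]
            have := fun h => hj (hj'.2 h)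
            omega
    · rw [total_eq, H.edge_app_eq _ _ _ (a := 0) (b := 1)
        (charMap_of_lt i.succ_pos) (charMap_of_le (Fin.le_last _)),
        edge_map_eq (SimplexCategory.σ i) _ _ (a := 0) (b := Fin.last n) ?_ ?_, total_eq]
      · exact Fin.ext ((predAbove_val _ _).trans (by simp))
      · exact Fin.predAbove_right_last ..

end Family

/-! ### Fans, atlases and transition functions -/

/-- The trivialization `β` agrees with the chosen trivializations over the edges `0 → k`. -/
def IsFan {F X B : SSet.{u}} (line : B _⦋1⦌ → Family F X 1) {n : ℕ} (b : B _⦋n⦌)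
    (β : Family F X n) : Prop :=
  ∀ (k : Fin (n + 1)) {m : ℕ} (θ : ⦋m⦌ ⟶ ⦋1⦌) (f : F _⦋m⦌),
    β.app (θ ≫ SimplexCategory.mkOfLe 0 k (Fin.zero_le _)) f =
      (line (edge B b 0 k (Fin.zero_le _))).app θ f

/-- Compatible choices of trivializations of a bundle over the edges and the 2-simplices of its
base, together with the transition functions between them. -/
structure Atlas (F : SSet.{u}) {X B : SSet.{u}} (τ : X ⟶ B) where
  /-- the unit of the fibre -/
  unit : F _⦋1⦌
  isOne_unit : IsOne F unit
  /-- the trivialization over the vertex -/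
  base : Family F X 0
  base_injective : ∀ {m : ℕ} (θ : ⦋m⦌ ⟶ ⦋0⦌), Function.Injective (base.app θ)
  /-- the trivializations over the edges -/
  line : B _⦋1⦌ → Family F X 1
  line_triv : ∀ g, IsTrivialization τ g (line g)
  line_zero : ∀ g {m : ℕ} (f : F _⦋m⦌), (line g).app (SimplexCategory.const ⦋m⦌ ⦋1⦌ 0) f =
    base.app (SimplexCategory.const ⦋m⦌ ⦋0⦌ 0) f
  line_one : ∀ g, IsOne B g → line g = base.pull (SimplexCategory.const ⦋1⦌ ⦋0⦌ 0)
  /-- the trivializations over the 2-simplices -/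
  fan : B _⦋2⦌ → Family F X 2
  fan_triv : ∀ c, IsTrivialization τ c (fan c)
  isFan_fan : ∀ c, IsFan line c (fan c)
  /-- the holonomy along the edges -/
  Ψ : B _⦋1⦌ → (F ≅ F)
  Ψ_one : ∀ g, IsOne B g → Ψ g = Iso.refl F
  line_Ψ : ∀ g {m : ℕ} (f : F _⦋m⦌), (line g).app (SimplexCategory.const ⦋m⦌ ⦋1⦌ 1)
    ((Ψ g).hom.app (op ⦋m⦌) f) = base.app (SimplexCategory.const ⦋m⦌ ⦋0⦌ 0) f
  /-- the transition functions over the last edges of the 2-simplices -/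
  trans : B _⦋2⦌ → Family F F 1
  isGauge_trans : ∀ c, (trans c).IsGauge
  fan_trans : ∀ c {m : ℕ} (θ : ⦋m⦌ ⟶ ⦋1⦌) (f : F _⦋m⦌),
    (fan c).app (θ ≫ SimplexCategory.mkOfLe 1 2 (by decide)) ((trans c).app θ f) =
      (line (edge B c 1 2 (by decide))).app θ f

section

variable {F X B : SSet.{u}} {τ : X ⟶ B}

/-- The edges 0 → k form a tree: normalize at the vertex 0, then glue in the given trivializations
one vertex at a time. -/
theorem IsFibreBundle.exists_isFan (hτ : IsFibreBundle F τ) (hB : IsReduced B) {v : B _⦋0⦌}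
    {base : Family F X 0} (hbase : IsTrivialization τ v base) {line : B _⦋1⦌ → Family F X 1}
    (hline : ∀ g, IsTrivialization τ g (line g))
    (line_zero : ∀ g {m : ℕ} (f : F _⦋m⦌), (line g).app (SimplexCategory.const ⦋m⦌ ⦋1⦌ 0) f =
      base.app (SimplexCategory.const ⦋m⦌ ⦋0⦌ 0) f)
    (line_one : ∀ g, IsOne B g → line g = base.pull (SimplexCategory.const ⦋1⦌ ⦋0⦌ 0))
    {n : ℕ} (b : B _⦋n⦌) :
    ∃ β : Family F X n, IsTrivialization τ b β ∧ IsFan line b β := by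
  suffices ∀ N : ℕ, ∃ β : Family F X n, IsTrivialization τ b β ∧
      ∀ k : Fin (n + 1), k.val ≤ N → ∀ {m : ℕ} (θ : ⦋m⦌ ⟶ ⦋1⦌) (f : F _⦋m⦌),
        β.app (θ ≫ SimplexCategory.mkOfLe 0 k (Fin.zero_le _)) f =
          (line (edge B b 0 k (Fin.zero_le _))).app θ f by
    obtain ⟨β, hβ, h⟩ := this n
    exact ⟨β, hβ, fun k => h k (Nat.lt_succ_iff.1 k.isLt)⟩
  intro N
  induction N with
  | zero =>
    obtain ⟨α, hα⟩ := hτ.exists_isTrivialization b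
    have hα' := hα.pull (SimplexCategory.const ⦋0⦌ ⦋n⦌ 0)
    rw [hB.vertex_eq (B.map _ b) v] at hα'
    obtain ⟨H, hH, hHb⟩ := hα'.exists_gauge hbase
    refine ⟨α.comp (H.pull (SimplexCategory.const ⦋n⦌ ⦋0⦌ 0)), hα.comp (hH.pull _),
      fun k hk m θ f => ?_⟩
    obtain rfl : k = 0 := Fin.ext (Nat.le_zero.1 hk)
    rw [line_one _ (isOne_edge_self b 0 _), Family.pull_app, SimplexCategory.mkOfLe_refl, ← hHb]
    rfl
  | succ N ih =>
    obtain ⟨α, hα, h⟩ := ih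
    by_cases hN : N + 1 < n + 1
    · have hk : (0 : Fin (n + 1)) < ⟨N + 1, hN⟩ := Nat.succ_pos N
      obtain ⟨β, hβ, h₁, h₂⟩ := hα.exists_glue hk (hline _) fun {m} f => by
        rw [line_zero, ← line_zero (edge B b 0 0 le_rfl) f, ← h 0 (Nat.zero_le _)]
        rfl
      refine ⟨β, hβ, fun j hj m θ f => ?_⟩
      rcases Nat.le_succ_iff.1 hj with hj | hj
      · rw [h₂, h j hj]
        intro i
        change (SimplexCategory.mkOfLe 0 j (Fin.zero_le _)).toOrderHom (θ.toOrderHom i) < _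
        refine lt_of_le_of_lt ((SimplexCategory.mkOfLe 0 j (Fin.zero_le _)).toOrderHom.monotone
          (Fin.le_last (θ.toOrderHom i))) ?_
        exact Nat.lt_succ_of_le hj
      · obtain rfl : j = ⟨N + 1, hN⟩ := Fin.ext hj
        exact h₁ θ f
    · exact ⟨α, hα, fun j _ => h j (by omega)⟩

theorem IsFibreBundle.nonempty_atlas (hτ : IsFibreBundle F τ) (hF : IsReduced F)
    (hB : IsReduced B) : Nonempty (Atlas F τ) := by
  obtain ⟨unit, isOne_unit⟩ := hF.exists_one
  obtain ⟨v, -⟩ := hB.exists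
  obtain ⟨base, hbase⟩ := hτ.exists_isTrivialization v
  have hline : ∀ g : B _⦋1⦌, ∃ α : Family F X 1, IsTrivialization τ g α ∧
      (∀ {m : ℕ} (f : F _⦋m⦌), α.app (SimplexCategory.const ⦋m⦌ ⦋1⦌ 0) f =
        base.app (SimplexCategory.const ⦋m⦌ ⦋0⦌ 0) f) ∧
      (IsOne B g → α = base.pull (SimplexCategory.const ⦋1⦌ ⦋0⦌ 0)) := by
    intro g
    by_cases hg : IsOne B g
    · refine ⟨base.pull (SimplexCategory.const ⦋1⦌ ⦋0⦌ 0), ?_, fun f => rfl, fun _ => rfl⟩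
      rw [hB.one_eq hg (isOne_map_const v 0)]
      exact hbase.pull _
    · obtain ⟨α, hα⟩ := hτ.exists_isTrivialization g
      have hα' := hα.pull (SimplexCategory.const ⦋0⦌ ⦋1⦌ 0)
      rw [hB.vertex_eq (B.map _ g) v] at hα'
      obtain ⟨H, hH, hHb⟩ := hα'.exists_gauge hbase
      refine ⟨α.comp (H.pull (SimplexCategory.const ⦋1⦌ ⦋0⦌ 0)), hα.comp (hH.pull _),
        fun f => ?_, fun h => absurd h hg⟩
      rw [← hHb]
      rfl
  choose line line_triv line_zero line_one using hline
  choose fan fan_triv isFan_fan using fun c : B _⦋2⦌ =>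
    hτ.exists_isFan hB hbase line_triv line_zero line_one c
  have hΨ : ∀ g : B _⦋1⦌, ∃ φ : F ≅ F, (IsOne B g → φ = Iso.refl F) ∧ ∀ {m : ℕ} (f : F _⦋m⦌),
      (line g).app (SimplexCategory.const ⦋m⦌ ⦋1⦌ 1) (φ.hom.app (op ⦋m⦌) f) =
        base.app (SimplexCategory.const ⦋m⦌ ⦋0⦌ 0) f := by
    intro g
    by_cases hg : IsOne B g
    · refine ⟨Iso.refl F, fun _ => rfl, fun f => ?_⟩
      rw [line_one g hg]
      rfl
    · have hα' := (line_triv g).pull (SimplexCategory.const ⦋0⦌ ⦋1⦌ 1)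
      rw [hB.vertex_eq (B.map _ g) v] at hα'
      obtain ⟨H, hH, hHb⟩ := hα'.exists_gauge hbase
      obtain ⟨φ, hφ⟩ := hH.exists_iso 0
      refine ⟨φ, fun h => absurd h hg, fun f => ?_⟩
      rw [hφ, ← hHb]
      rfl
  choose Ψ Ψ_one line_Ψ using hΨ
  choose trans isGauge_trans fan_trans using fun c : B _⦋2⦌ =>
    ((fan_triv c).pull (SimplexCategory.mkOfLe (n := 2) 1 2 (by decide))).exists_gauge
      (line_triv (edge B c 1 2 (by decide)))
  exact ⟨⟨unit, isOne_unit, base, hbase.injective, line, line_triv, line_zero, line_one, fan,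
    fan_triv, isFan_fan, Ψ, Ψ_one, line_Ψ, trans, isGauge_trans, fan_trans⟩⟩

/-- Two trivializations which agree over the edges `0 → 1` and `0 → 2` agree over `1 → 2`. -/
theorem IsFan.app_eq {line : B _⦋1⦌ → Family F X 1} {c : B _⦋2⦌} {α β : Family F X 2}
    (hα : IsFan line c α) (hβ : IsFan line c β) (hα' : IsTrivialization τ c α)
    (hβ' : IsTrivialization τ c β) (hF : IsReduced F) (hN : IsN F) (f : F _⦋1⦌) :
    β.app (SimplexCategory.mkOfLe 1 2 (by decide)) f =
      α.app (SimplexCategory.mkOfLe 1 2 (by decide)) f := by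
  obtain ⟨H, -, hH⟩ := hα'.exists_gauge hβ'
  have key : ∀ (k : Fin 3) (f : F _⦋1⦌),
      H.app (SimplexCategory.mkOfLe 0 k (Fin.zero_le _)) f = f := fun k f => by
    apply hα'.injective
    rw [hH]
    have h₁ := hα k (𝟙 _) f
    have h₂ := hβ k (𝟙 _) f
    rw [Category.id_comp] at h₁ h₂
    rw [h₁, h₂]
  -- In y the edge 0 → 1 is a unit while 0 → 2 and 1 → 2 are both f. The transition H fixes edges
  -- over 0 → k, so the image of y still has a unit as first edge, and H must fix f over 1 → 2.
  let y := F.map (charMap (n := 2) 2).op f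
  have hy₁ : IsOne F (edge F (H.app (𝟙 _) y) 0 1 (by decide)) := by
    rw [H.edge_app_eq _ _ _ (a := 0) (b := 1) rfl rfl, key,
      edge_map_eq (charMap 2) f _ (a := 0) (b := 0) rfl rfl]
    exact isOne_edge_self _ _ _
  have := edge_eq_of_isOne_left hF hN (H.app (𝟙 _) y) (i := 0) (j := 1) (k := 2) (by decide)
    (by decide) hy₁
  rw [H.edge_app_eq _ _ _ (a := 0) (b := 2) rfl rfl, H.edge_app_eq _ _ _ (a := 1) (b := 2) rfl rfl,
    edge_map_eq (charMap 2) f _ (a := 0) (b := 1) rfl rfl,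
    edge_map_eq (charMap 2) f _ (a := 0) (b := 1) rfl rfl, edge_self_one, key] at this
  rw [← hH, ← this]

namespace Atlas

variable (A : Atlas F τ)

/-- For c = [g|h], the vertex 1 is the far end of g and the starting point of h. So the transition
begins at Ψ_g; by `trans_one` it ends at Ψ_{gh} Ψ_h⁻¹. -/
theorem trans_zero (c : B _⦋2⦌) (f : F _⦋1⦌) :
    (A.trans c).app (SimplexCategory.const ⦋1⦌ ⦋1⦌ 0) f =
      act (A.Ψ (edge B c 0 1 (by decide))) f := by
  apply (A.fan_triv c).injective (SimplexCategory.const ⦋1⦌ ⦋2⦌ 1)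
  refine (A.fan_trans c (SimplexCategory.const ⦋1⦌ ⦋1⦌ 0) f).trans ?_
  rw [A.line_zero, ← A.line_Ψ (edge B c 0 1 (by decide)), ← A.isFan_fan c 1]
  rfl

theorem trans_one (c : B _⦋2⦌) (f : F _⦋1⦌) :
    (A.trans c).app (SimplexCategory.const ⦋1⦌ ⦋1⦌ 1)
        (act (A.Ψ (edge B c 1 2 (by decide))) f) =
      act (A.Ψ (edge B c 0 2 (by decide))) f := by
  apply (A.fan_triv c).injective (SimplexCategory.const ⦋1⦌ ⦋2⦌ 2)
  refine (A.fan_trans c (SimplexCategory.const ⦋1⦌ ⦋1⦌ 1) _).trans ?_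
  rw [act, A.line_Ψ, ← A.line_Ψ (edge B c 0 2 (by decide)), ← A.isFan_fan c 2]
  rfl

/-- The defect of multiplicativity of the sections of the bundle over the edges. -/
def η (c : B _⦋2⦌) : F _⦋1⦌ :=
  (A.trans c).app (SimplexCategory.mkOfLe 0 1 (by decide)) A.unit

/-- The edge of `X` over `g` with coordinate `x`. -/
def lift (g : B _⦋1⦌) (x : F _⦋1⦌) : X _⦋1⦌ :=
  (A.line g).app (SimplexCategory.mkOfLe 0 1 (by decide)) x

theorem lift_injective (g : B _⦋1⦌) : Function.Injective (A.lift g) :=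
  (A.line_triv g).injective _

theorem app_lift (g : B _⦋1⦌) (x : F _⦋1⦌) : τ.app (op ⦋1⦌) (A.lift g x) = g :=
  ((A.line_triv g).proj _ x).trans (edge_self_one g)

theorem lift_of_isOne {g : B _⦋1⦌} (hg : IsOne B g) (x : F _⦋1⦌) :
    A.lift g x = A.base.app (SimplexCategory.const ⦋1⦌ ⦋0⦌ 0) x := by
  rw [lift, A.line_one g hg]
  rfl

theorem isOne_lift_iff (hX : IsReduced X) (g : B _⦋1⦌) (x : F _⦋1⦌) :
    IsOne X (A.lift g x) ↔ IsOne F x ∧ IsOne B g := by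
  constructor
  · intro h
    have hg : IsOne B g := by
      rw [← A.app_lift g x]
      exact h.app τ
    rw [lift_of_isOne A hg] at h
    refine ⟨?_, hg⟩
    rw [A.base_injective _ (hX.one_eq h (A.base.isOne_app_const 0 A.isOne_unit))]
    exact A.isOne_unit
  · rintro ⟨hx, hg⟩
    rw [lift_of_isOne A hg]
    exact A.base.isOne_app_const 0 hx

theorem fan_zero {n : ℕ} {b : B _⦋n⦌} {β : Family F X n} (hβ : IsFan A.line b β)
    (k : Fin (n + 1)) (x : F _⦋1⦌) :
    β.app (SimplexCategory.mkOfLe 0 k (Fin.zero_le _)) x =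
      A.lift (edge B b 0 k (Fin.zero_le _)) x := by
  rw [lift, ← hβ]
  congr 1
  exact SimplexCategory.Hom.ext_one_left _ _

/-- A fan restricts to a fan over the face 0 → j → k, and there `IsFan.app_eq` identifies it over j
→ k with the chosen one. -/
theorem fan_app (hF : IsReduced F) (hN : IsN F) {n : ℕ} {b : B _⦋n⦌} {β : Family F X n}
    (hβ : IsFan A.line b β) (hβ' : IsTrivialization τ b β) (j k : Fin (n + 1)) (h : j ≤ k)
    (x : F _⦋1⦌) :
    β.app (SimplexCategory.mkOfLe j k h)
      ((A.trans (face B b 0 j k (Fin.zero_le _) h)).app (SimplexCategory.mkOfLe 0 1 (by decide)) x) =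
    A.lift (edge B b j k h) x := by
  have h₁ : IsFan A.line (face B b 0 j k (Fin.zero_le _) h)
      (β.pull (SimplexCategory.mkOfLeComp 0 j k (Fin.zero_le _) h)) := by
    intro i m θ f
    rw [Family.pull_app, Category.assoc, mkOfLe_comp, edge_face]
    exact hβ _ θ f
  have h₂ := h₁.app_eq (A.isFan_fan _) (hβ'.pull _) (A.fan_triv _) hF hN
    ((A.trans (face B b 0 j k (Fin.zero_le _) h)).app (SimplexCategory.mkOfLe 0 1 (by decide)) x)
  have h₃ := A.fan_trans (face B b 0 j k (Fin.zero_le _) h)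
    (SimplexCategory.mkOfLe 0 1 (by decide)) x
  rw [mkOfLe_comp] at h₃
  rw [edge_face_one_two] at h₃
  rw [lift, ← h₃]
  refine Eq.trans ?_ h₂.symm
  rw [Family.pull_app, mkOfLe_comp]
  rfl

theorem fan_one_two (c : B _⦋2⦌) (x : F _⦋1⦌) :
    (A.fan c).app (SimplexCategory.mkOfLe 1 2 (by decide))
      ((A.trans c).app (SimplexCategory.mkOfLe 0 1 (by decide)) x) =
    A.lift (edge B c 1 2 (by decide)) x := by
  rw [lift, ← A.fan_trans, mkOfLe_comp]
  rfl

/-- The product of two elements of the section defined by the trivializations over the edges. -/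
theorem exists_mul_section (hF : IsReduced F) (c : B _⦋2⦌) : ∃ x : X _⦋2⦌,
    τ.app (op ⦋2⦌) x = c ∧
    edge X x 0 1 (by decide) = A.lift (edge B c 0 1 (by decide)) A.unit ∧
    edge X x 1 2 (by decide) = A.lift (edge B c 1 2 (by decide)) A.unit ∧
    edge X x 0 2 (by decide) = A.lift (edge B c 0 2 (by decide)) (A.η c) := by
  -- The coordinate is the degenerate triangle [1|η]; over 1 → 2 the coordinate η represents the
  -- unit section, by definition of η.
  refine ⟨(A.fan c).app (𝟙 _) (F.map (charMap (n := 2) 2).op (A.η c)), ?_, ?_, ?_, ?_⟩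
  · rw [(A.fan_triv c).proj]
    simp
  · rw [(A.fan c).edge_app_eq _ _ _ (a := 0) (b := 1) rfl rfl, A.fan_zero (A.isFan_fan c),
      edge_map_eq (charMap 2) _ _ (a := 0) (b := 0) rfl rfl, edge_eq_one hF A.isOne_unit]
  · rw [(A.fan c).edge_app_eq _ _ _ (a := 1) (b := 2) rfl rfl,
      edge_map_eq (charMap 2) _ _ (a := 0) (b := 1) rfl rfl, edge_self_one, η, A.fan_one_two]
  · rw [(A.fan c).edge_app_eq _ _ _ (a := 0) (b := 2) rfl rfl, A.fan_zero (A.isFan_fan c),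
      edge_map_eq (charMap 2) _ _ (a := 0) (b := 1) rfl rfl, edge_self_one]

end Atlas

end

/-! ### The twisting relations -/

namespace Atlas

variable {F X B : SSet.{u}} {τ : X ⟶ B} (A : Atlas F τ)

theorem η_of_isOne_left (hF : IsReduced F) (hB : IsReduced B) (hBN : IsN B) (hX : IsReduced X)
    (hXN : IsN X) {c : B _⦋2⦌} (hc : IsOne B (edge B c 0 1 (by decide))) : A.η c = A.unit := by
  obtain ⟨x, -, h01, h12, h02⟩ := A.exists_mul_section hF c
  have hx : IsOne X (edge X x 0 1 (by decide)) := by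
    rw [h01, A.isOne_lift_iff hX]
    exact ⟨A.isOne_unit, hc⟩
  have := edge_eq_of_isOne_left hX hXN x (i := 0) (j := 1) (k := 2) (by decide) (by decide) hx
  rw [h02, h12, edge_eq_of_isOne_left hB hBN c (i := 0) (j := 1) (k := 2) (by decide) (by decide)
    hc] at this
  exact A.lift_injective _ this

theorem η_of_isOne_right (hF : IsReduced F) (hB : IsReduced B) (hBN : IsN B) (hX : IsReduced X)
    (hXN : IsN X) {c : B _⦋2⦌} (hc : IsOne B (edge B c 1 2 (by decide))) : A.η c = A.unit := by
  obtain ⟨x, -, h01, h12, h02⟩ := A.exists_mul_section hF c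
  have hx : IsOne X (edge X x 1 2 (by decide)) := by
    rw [h12, A.isOne_lift_iff hX]
    exact ⟨A.isOne_unit, hc⟩
  have := edge_eq_of_isOne_right hX hXN x (i := 0) (j := 1) (k := 2) (by decide) (by decide) hx
  rw [h02, h01, edge_eq_of_isOne_right hB hBN c (i := 0) (j := 1) (k := 2) (by decide) (by decide)
    hc] at this
  exact A.lift_injective _ this

/-- Both products are the diagonal of the same square, the transition homotopy applied to Ψ_h(x). -/
theorem homotopy (hF : IsReduced F) (c : B _⦋2⦌) (x : F _⦋1⦌) : ∃ z : F _⦋1⦌,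
    IsProd F ![act (A.Ψ (enum B c 0)) (act (A.Ψ (enum B c 1)) x), A.η c] z ∧
    IsProd F ![A.η c, act (A.Ψ (total B c)) x] z := by
  have h0 : enum B c 0 = edge B c 0 1 (by decide) := enum_eq c 0
  have h1 : enum B c 1 = edge B c 1 2 (by decide) := enum_eq c 1
  have h2 : total B c = edge B c 0 2 (by decide) := total_eq c
  rw [h0, h1, h2, ← A.trans_zero c, ← A.trans_one c]
  exact ⟨_, Family.isProd_vertex_one hF A.isOne_unit _ _,
    Family.isProd_one_vertex hF A.isOne_unit _ _⟩

theorem isProd_Ψ_η_iff (hF : IsReduced F) (hN : IsN F) (c : B _⦋2⦌) (x z : F _⦋1⦌) :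
    IsProd F ![act (A.Ψ (edge B c 0 1 (by decide))) x, A.η c] z ↔
      z = (A.trans c).app (SimplexCategory.mkOfLe 0 1 (by decide)) x := by
  rw [← A.trans_zero]
  exact Family.isProd_vertex_one_iff hF hN A.isOne_unit _ _ _

theorem cocycle (hF : IsReduced F) (hN : IsN F) (b : B _⦋3⦌) {β : Family F X 3}
    (hβ : IsFan A.line b β) (hβ' : IsTrivialization τ b β) : ∃ z : F _⦋1⦌,
    IsProd F ![act (A.Ψ (enum B b 0)) (A.η (face B b 1 2 3 (by decide) (by decide))),
      A.η (face B b 0 1 3 (by decide) (by decide))] z ∧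
    IsProd F ![A.η (face B b 0 1 2 (by decide) (by decide)),
      A.η (face B b 0 2 3 (by decide) (by decide))] z := by
  have h0 : enum B b 0 = edge B (face B b 0 1 3 (by decide) (by decide)) 0 1 (by decide) :=
    (enum_eq b 0).trans (edge_face_zero_one ..).symm
  refine ⟨(A.trans (face B b 0 1 3 (by decide) (by decide))).app
    (SimplexCategory.mkOfLe 0 1 (by decide)) (A.η (face B b 1 2 3 (by decide) (by decide))),
    ?_, ?_⟩
  · rw [h0, A.isProd_Ψ_η_iff hF hN]
  -- The product of the unit sections over the face 1 → 2 → 3, read in the fan of the 3-simplex, is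
  -- a triangle in F with edges η(0,1,2), η(0,2,3) and the common value z.
  · obtain ⟨x, hx, h01, h12, h02⟩ := A.exists_mul_section hF
      (face B b 1 2 3 (by decide) (by decide))
    obtain ⟨y, rfl⟩ := hβ'.exists_eq (SimplexCategory.mkOfLeComp 1 2 3 (by decide) (by decide)) x hx
    rw [β.edge_app_eq _ _ _ (a := 1) (b := 2) rfl rfl, edge_face_zero_one,
      ← A.fan_app hF hN hβ hβ'] at h01
    rw [β.edge_app_eq _ _ _ (a := 2) (b := 3) rfl rfl, edge_face_one_two,
      ← A.fan_app hF hN hβ hβ'] at h12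
    rw [β.edge_app_eq _ _ _ (a := 1) (b := 3) rfl rfl, edge_face_zero_two,
      ← A.fan_app hF hN hβ hβ'] at h02
    exact isProd_two_iff.2 ⟨y, hβ'.injective _ h01, hβ'.injective _ h12, hβ'.injective _ h02⟩

/-- The pairs `(x, g)` are the edges of `X`. -/
noncomputable def liftEquiv : F _⦋1⦌ × B _⦋1⦌ ≃ X _⦋1⦌ :=
  Equiv.ofBijective (fun p => A.lift p.2 p.1) <| by
    constructor
    · rintro ⟨x, g⟩ ⟨y, h⟩ hxy
      obtain rfl : g = h := by
        rw [← A.app_lift g x, ← A.app_lift h y]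
        exact congrArg _ hxy
      exact congrArg (·, g) (A.lift_injective g hxy)
    · intro x
      obtain ⟨f, hf⟩ := (A.line_triv (τ.app (op ⦋1⦌) x)).exists_eq
        (SimplexCategory.mkOfLe 0 1 (by decide)) x (edge_self_one _).symm
      exact ⟨(f, τ.app (op ⦋1⦌) x), hf⟩

theorem liftEquiv_apply (p : F _⦋1⦌ × B _⦋1⦌) : A.liftEquiv p = A.lift p.2 p.1 := rfl

end Atlas

/-! ### The explicit model -/

theorem IsFibreBundle.exists_isExplicitModel {F X B : SSet.{u}} {τ : X ⟶ B}
    (hτ : IsFibreBundle F τ) (hF : IsReduced F) (hN : IsN F) (hB : IsReduced B) (hBN : IsN B) :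
    ∃ (P : TwistingPair F B) (e : F _⦋1⦌ × B _⦋1⦌ ≃ X _⦋1⦌), IsExplicitModel τ P e := by
  obtain ⟨A⟩ := hτ.nonempty_atlas hF hB
  have hX := hτ.isReduced hF hB
  have hXN := hτ.isN hN hBN
  have hfan : ∀ {n : ℕ} (b : B _⦋n⦌), ∃ β : Family F X n, IsTrivialization τ b β ∧
      IsFan A.line b β := fun b => by
    obtain ⟨v, -⟩ := hB.exists
    obtain ⟨g, hg⟩ := hB.exists_one
    refine hτ.exists_isFan hB (v := v) ?_ A.line_triv A.line_zero A.line_one b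
    -- The base trivialization is recovered as the restriction to a vertex of the one over the unit
    -- edge.
    have := (A.line_triv g).pull (SimplexCategory.const ⦋0⦌ ⦋1⦌ 0)
    rw [hB.vertex_eq (B.map _ g) v, A.line_one g hg] at this
    convert this using 1
    ext m θ f
    exact congrArg (A.base.app · f) (Subsingleton.elim _ _)
  let P : TwistingPair F B :=
    { Ψ := A.Ψ
      η := A.η
      normalizing := fun c => (A.isGauge_trans c).isNormalizing hF A.isOne_unit
      Ψ_one := A.Ψ_one
      η_one_left := fun g => by
        rw [A.η_of_isOne_left hF hB hBN hX hXN]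
        · exact A.isOne_unit
        · rw [SimplicialObject.σ, edge_map_eq (SimplexCategory.σ 0) g _ (a := 0) (b := 0) rfl rfl]
          exact isOne_edge_self _ _ _
      η_one_right := fun g => by
        rw [A.η_of_isOne_right hF hB hBN hX hXN]
        · exact A.isOne_unit
        · rw [SimplicialObject.σ, edge_map_eq (SimplexCategory.σ 1) g _ (a := 1) (b := 1) rfl rfl]
          exact isOne_edge_self _ _ _
      homotopy := A.homotopy hF
      cocycle := fun b => by
        obtain ⟨β, hβ, hβ'⟩ := hfan b
        exact A.cocycle hF hN b hβ' hβ }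
  refine ⟨P, A.liftEquiv, ⟨fun p => A.app_lift _ _, fun p => A.isOne_lift_iff hX _ _,
    fun n w => ⟨?_, ?_⟩, fun p q r => ⟨?_, ?_⟩⟩⟩
  · rintro ⟨x, hx⟩
    obtain ⟨β, hβ, hβ'⟩ := hfan (τ.app (op ⦋n⦌) x)
    obtain ⟨y, hy⟩ := hβ.exists_app_id_eq rfl
    have hb : ∀ k, enum B (τ.app (op ⦋n⦌) x) k = (w k).2 := fun k => by
      rw [← app_enum, hx]
      exact A.app_lift _ _
    refine ⟨τ.app (op ⦋n⦌) x, y, funext hb, fun k => ?_⟩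
    rw [← edge_face_zero_one (τ.app (op ⦋n⦌) x) 0 k.castSucc k.succ (Fin.zero_le _)
      k.castSucc_le_succ]
    refine (A.isProd_Ψ_η_iff hF hN _ _ _).2 (hβ.injective (SimplexCategory.mkOfLe k.castSucc k.succ
      k.castSucc_le_succ) ?_)
    rw [A.fan_app hF hN hβ' hβ, ← enum_eq, hb, ← A.liftEquiv_apply, ← congrFun hx k, ← hy,
      enum_eq, enum_eq]
    exact (β.edge_app_eq (𝟙 _) y _ rfl rfl).symm
  · rintro ⟨b, y, hb, hy⟩
    obtain ⟨β, hβ, hβ'⟩ := hfan b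
    refine ⟨β.app (𝟙 _) y, funext fun k => ?_⟩
    have hyk := hy k
    rw [← edge_face_zero_one b 0 k.castSucc k.succ (Fin.zero_le _) k.castSucc_le_succ] at hyk
    rw [A.liftEquiv_apply, ← congrFun hb k, enum_eq, enum_eq, ← A.fan_app hF hN hβ' hβ,
      ← (A.isProd_Ψ_η_iff hF hN _ _ _).1 hyk, enum_eq]
    exact β.edge_app_eq (𝟙 _) y _ rfl rfl
  · intro h
    obtain ⟨x, h01, h12, h02⟩ := isProd_two_iff.1 h
    rw [A.liftEquiv_apply] at h01 h12 h02
    obtain ⟨b, hb⟩ : ∃ b, τ.app (op ⦋2⦌) x = b := ⟨_, rfl⟩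
    have hb01 : edge B b 0 1 (by decide) = p.2 := by rw [← hb, ← app_edge, h01, A.app_lift]
    have hb12 : edge B b 1 2 (by decide) = q.2 := by rw [← hb, ← app_edge, h12, A.app_lift]
    have hb02 : edge B b 0 2 (by decide) = r.2 := by rw [← hb, ← app_edge, h02, A.app_lift]
    obtain ⟨y, rfl⟩ := (A.fan_triv b).exists_app_id_eq hb
    rw [(A.fan b).edge_app_eq _ _ _ (a := 0) (b := 1) rfl rfl, A.fan_zero (A.isFan_fan b),
      hb01] at h01
    rw [(A.fan b).edge_app_eq _ _ _ (a := 1) (b := 2) rfl rfl, ← hb12, ← A.fan_one_two] at h12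
    rw [(A.fan b).edge_app_eq _ _ _ (a := 0) (b := 2) rfl rfl, A.fan_zero (A.isFan_fan b),
      hb02] at h02
    refine ⟨b, funext fun k => ?_, hb02, ?_⟩
    · fin_cases k
      · exact (enum_eq b 0).trans hb01
      · exact (enum_eq b 1).trans hb12
    · change IsProd F ![p.1, act (A.Ψ p.2) q.1, A.η b] r.1
      rw [← hb01, ← A.trans_zero]
      -- The fan gives only the triangle with edges x₁ and Ψ(x₂)·η; the model demands the
      -- three-letter word.
      refine ((A.isGauge_trans b).isProd_three_iff hF hN A.isOne_unit _ _ _).2 ?_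
      exact isProd_two_iff.2 ⟨y, A.lift_injective _ h01, (A.fan_triv b).injective _ h12,
        A.lift_injective _ h02⟩
  · rintro ⟨b, hb, hb02, h⟩
    have hb01 : edge B b 0 1 (by decide) = p.2 := (enum_eq b 0).symm.trans (congrFun hb 0)
    have hb12 : edge B b 1 2 (by decide) = q.2 := (enum_eq b 1).symm.trans (congrFun hb 1)
    have hb02 : edge B b 0 2 (by decide) = r.2 := hb02
    change IsProd F ![p.1, act (A.Ψ p.2) q.1, A.η b] r.1 at h
    rw [← hb01, ← A.trans_zero] at h
    obtain ⟨y, h01, h12, h02⟩ := isProd_two_iff.1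
      (((A.isGauge_trans b).isProd_three_iff hF hN A.isOne_unit _ _ _).1 h)
    refine isProd_two_iff.2 ⟨(A.fan b).app (𝟙 _) y, ?_, ?_, ?_⟩
    · rw [(A.fan b).edge_app_eq _ _ _ (a := 0) (b := 1) rfl rfl, A.fan_zero (A.isFan_fan b), hb01,
        h01, A.liftEquiv_apply]
    · rw [(A.fan b).edge_app_eq _ _ _ (a := 1) (b := 2) rfl rfl, h12, A.fan_one_two, hb12,
        A.liftEquiv_apply]
    · rw [(A.fan b).edge_app_eq _ _ _ (a := 0) (b := 2) rfl rfl, A.fan_zero (A.isFan_fan b), hb02,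
        h02, A.liftEquiv_apply]

end PartialGroups

theorem theoremA {F X B : SSet.{u}} (τ : X ⟶ B)
    (hF : PartialGroups.IsPartialGroup F) (hB : PartialGroups.IsPartialGroup B)
    (hτ : PartialGroups.IsFibreBundle F τ) :
    PartialGroups.IsPartialGroup X ∧
    ∃ (P : PartialGroups.TwistingPair F B) (e : F _⦋1⦌ × B _⦋1⦌ ≃ X _⦋1⦌),
      PartialGroups.IsExplicitModel τ P e :=
  ⟨hτ.isPartialGroup hF hB, hτ.exists_isExplicitModel hF.1 hF.2.1 hB.1 hB.2.1⟩
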